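/- Let $N\ge 0$ be an integer and $K\in\mathbb R$; sums over repeated indices (from $1$ to $N$) are understood. **Setting.** Fields are smooth compactly supported maps $u=(u^1,\dots,u^N):\mathbb R\to\mathbb R^N$, and $(d/dx)^{-1}f(x)=\tfrac12\big(\int_{-\infty}^x f-\int_x^{\infty} f\big)$. A smooth functional $I[u]$ is one that has a variational derivative $\delta I/\delta u^i(x)$, that is, $\frac{d}{d\varepsilon}I[u+\varepsilon v]\big|_{\varepsilon=0}=\int \frac{\delta I}{\delta u^i(x)}v^i(x)\,dx$ for all fields $u,v$, such that $I$ and $\delta I/\delta u$ depend smoothly on the field along every smooth finite-parameter family of fields (smooth jointly in the parameters and $x$, with supports in a common compact set locally uniformly in the parameters), where along such families $\delta I/\delta u^i(x)$ is smooth jointly in the parameters and $x$, and is equal, off a compact set that is locally uniform in the parameters, to one constant (depending on the field, the same near $+\infty$ and $-\infty$). Given functions $g^{ij}(u)$, $b^{ij}_k(u)$ on $\mathbb R^N$, put $$\{I,J\}=\int \frac{\delta I}{\delta u^i(x)}\Big(g^{ij}(u)\frac{d}{dx}+b^{ij}_k(u)u^k_x+K u^i_x\Big(\frac{d}{dx}\Big)^{-1}u^j_x\Big)\frac{\delta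 J}{\delta u^j(x)}\,dx .$$ It is a Poisson bracket if the smooth functionals form an algebra closed under $\{\cdot,\cdot\}$, on which the bracket is bilinear, skew-symmetric, satisfies the Leibniz rule and the Jacobi identity. **Part 1.** Let $(\eta^{ij})$ be a constant symmetric nondegenerate real matrix, $c^i_k,c^i\in\mathbb R$ arbitrary constants and $H^i(u)=c^i_ku^k+c^i$. Then for all indices and all $u\in\mathbb R^N$ $$\frac{\partial^2 H^i}{\partial u^k\partial u^s}\eta^{sp}\frac{\partial^2 H^j}{\partial u^p\partial u^l}=\frac{\partial^2 H^j}{\partial u^k\partial u^s}\eta^{sp}\frac{\partial^2 H^i}{\partial u^p\partial u^l},$$ $$\Big(\eta^{ir}\frac{\partial H^s}{\partial u^r}+\eta^{sr}\frac{\partial H^i}{\partial u^r}-Ku^iu^s\Big)\eta^{jp}\frac{\partial^2H^k}{\partial u^p\partial u^s}=\Big(\eta^{jr}\frac{\partial H^s}{\partial u^r}+\eta^{sr}\frac{\partial H^j}{\partial u^r}-Ku^ju^s\Big)\eta^{ip}\frac{\partial^2H^k}{\partial u^p\partial u^s}.$$ For these $H^i$ the coefficients $g^{ij}=\eta^{is}\frac{\partial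 H^j}{\partial u^s}+\eta^{js}\frac{\partial H^i}{\partial u^s}-Ku^iu^j$ and $b^{ij}_k=\eta^{is}\frac{\partial^2H^j}{\partial u^s\partial u^k}-K\delta^i_ku^j$ are $g^{ij}=\eta^{is}c^j_s+\eta^{js}c^i_s-Ku^iu^j$ and $b^{ij}_k=-K\delta^i_ku^j$, and the bracket with these coefficients, i.e. $$\{I,J\}=\int\frac{\delta I}{\delta u^i(x)}\Big(\big[\eta^{is}c^j_s+\eta^{js}c^i_s-Ku^iu^j\big]\frac{d}{dx}-K\delta^i_ku^ju^k_x+Ku^i_x\Big(\frac{d}{dx}\Big)^{-1}u^j_x\Big)\frac{\delta J}{\delta u^j(x)}\,dx ,$$ is a Poisson bracket. **Part 2.** Let $(\mu^{ij})$ be any constant symmetric real matrix and $g^{ij}(u)=\mu^{ij}-Ku^iu^j$. On every open set $\Omega\subseteq\mathbb R^N$ on which $\det(g^{ij}(u))\ne0$ everywhere, $g^{ij}$ is a contravariant pseudo-Riemannian metric of constant Riemannian curvature $K$, i.e. it is smooth, symmetric and nondegenerate, and its Riemann tensor satisfies $R^i{}_{jkl}=K(\delta^i_kg_{jl}-\delta^i_lg_{jk})$,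 where $R^i{}_{jkl}=\partial_k\Gamma^i_{lj}-\partial_l\Gamma^i_{kj}+\Gamma^i_{km}\Gamma^m_{lj}-\Gamma^i_{lm}\Gamma^m_{kj}$ and $\Gamma^j_{sk}$ are the Christoffel symbols of its Levi-Civita connection; moreover $\Gamma^{ij}_k:=g^{is}\Gamma^j_{sk}=K\delta^i_ku^j$ on $\Omega$. If $\det(\mu^{ij})\neq0$, then $\det(g^{ij}(u))\ne0$ for all $u$ in some neighbourhood of $0$. -/

import Mathlib

open scoped ContDiff

noncomputable section

namespace HydroBracket

/-! ### Fields, functionals and variational derivatives -/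

/-- The phase space: smooth compactly supported fields `x ↦ (u¹(x), …, u^N(x))` on the line. -/
def fieldSpace (N : ℕ) : Submodule ℝ (ℝ → Fin N → ℝ) where
  carrier := {u | ContDiff ℝ ∞ u ∧ HasCompactSupport u}
  add_mem' := fun ha hb => ⟨ha.1.add hb.1, ha.2.add hb.2⟩
  zero_mem' := ⟨contDiff_const, HasCompactSupport.zero⟩
  smul_mem' := fun r _ ha => ⟨contDiff_const.smul ha.1, ha.2.mono fun x hx h0 => hx (by
    simp [Pi.smul_apply, h0])⟩

/-- Functionals `I[u]` on the phase space. -/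
abbrev Functional (N : ℕ) : Type := fieldSpace N → ℝ

/-- A smooth `k`-parameter family of fields: jointly smooth in the parameter and in `x`, with
supports that stay in a common compact set as long as the parameter does. -/
structure IsSmoothFieldFamily {N k : ℕ} (c : (Fin k → ℝ) → fieldSpace N) : Prop where
  smooth : ContDiff ℝ ∞ (fun p : (Fin k → ℝ) × ℝ => (c p.1 : ℝ → Fin N → ℝ) p.2)
  support : ∀ S : Set (Fin k → ℝ), IsCompact S →
    ∃ R : ℝ, ∀ t ∈ S, ∀ x : ℝ, R < |x| → (c t : ℝ → Fin N → ℝ) x = 0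

/-- A smooth `k`-parameter family of covector fields `x ↦ (ξ₁(x), …, ξ_N(x))`: jointly smooth, and
equal to one constant near both ends of the line, off a compact set that is locally uniform in the
parameter. (The constant is allowed to be nonzero, so that functionals such as `∫ uⁱ dx`, whose
variational derivative is constant, are included.) -/
structure IsSmoothCovectorFamily {N k : ℕ} (ξ : (Fin k → ℝ) → ℝ → Fin N → ℝ) : Prop where
  smooth : ContDiff ℝ ∞ (fun p : (Fin k → ℝ) × ℝ => ξ p.1 p.2)
  constant : ∀ S : Set (Fin k → ℝ), IsCompact S →
    ∃ R : ℝ, ∀ t ∈ S, ∃ a : Fin N → ℝ, ∀ x : ℝ, R < |x| → ξ t x = a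

/-- `I` is a smooth functional with variational derivative `G`, where `G u x i` is
`δI/δuⁱ(x)` at the field `u`:
the derivative of `I` at `u` in every direction `v` is `∫ (δI/δuⁱ(x)) vⁱ(x) dx`, and both `I` and
its variational derivative depend smoothly on the field (along all smooth families of fields). -/
structure HasVarDeriv {N : ℕ} (I : Functional N) (G : fieldSpace N → ℝ → Fin N → ℝ) : Prop where
  deriv_eq : ∀ u v : fieldSpace N,
    HasDerivAt (fun ε : ℝ => I (u + ε • v))
      (∫ x : ℝ, ∑ i, G u x i * (v : ℝ → Fin N → ℝ) x i) 0
  smooth : ∀ (k : ℕ) (c : (Fin k → ℝ) → fieldSpace N), IsSmoothFieldFamily c →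
    ContDiff ℝ ∞ (fun t => I (c t))
  smooth_grad : ∀ (k : ℕ) (c : (Fin k → ℝ) → fieldSpace N), IsSmoothFieldFamily c →
    IsSmoothCovectorFamily (fun t => G (c t))

/-- The class of smooth functionals (those having a variational derivative). -/
def smoothFunctionals (N : ℕ) : Set (Functional N) := {I | ∃ G, HasVarDeriv I G}

open Classical in
/-- The variational derivative `δI/δuⁱ(x)` of a smooth functional (it is unique; the value for
other functionals is irrelevant and set to `0`). -/
def varDeriv {N : ℕ} (I : Functional N) : fieldSpace N → ℝ → Fin N → ℝ :=
  if h : ∃ G, HasVarDeriv I G then h.choose else 0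

/-! ### Nonlocal brackets of hydrodynamic type -/

/-- The skew-symmetric inverse `(d/dx)⁻¹ f (x) = ½ (∫_{-∞}^x f - ∫_x^∞ f)` of `d/dx`. -/
def invD (f : ℝ → ℝ) (x : ℝ) : ℝ :=
  (1 / 2) * ((∫ y in Set.Iic x, f y) - ∫ y in Set.Ioi x, f y)

/-- The operator `g^{ij}(u) d/dx + b^{ij}_k(u) u^k_x + K uⁱ_x (d/dx)⁻¹ u^j_x`
applied to a covector field `ξ_j(x)`. Here `g u i j` is `g^{ij}(u)` and `b u i j k` is
`b^{ij}_k(u)`. -/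
def hydroOp {N : ℕ} (g : (Fin N → ℝ) → Matrix (Fin N) (Fin N) ℝ)
    (b : (Fin N → ℝ) → Fin N → Fin N → Fin N → ℝ) (K : ℝ)
    (u ξ : ℝ → Fin N → ℝ) (x : ℝ) (i : Fin N) : ℝ :=
  ∑ j, (g (u x) i j * deriv (fun y => ξ y j) x
    + (∑ k, b (u x) i j k * deriv (fun y => u y k) x) * ξ x j
    + K * deriv (fun y => u y i) x * invD (fun y => deriv (fun z => u z j) y * ξ y j) x)

/-- The bracket `{I, J} = ∫ (δI/δuⁱ(x)) (g^{ij}(u) d/dx + b^{ij}_k(u) u^k_x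
+ K uⁱ_x (d/dx)⁻¹ u^j_x) (δJ/δu^j(x)) dx`. -/
def hydroBracket {N : ℕ} (g : (Fin N → ℝ) → Matrix (Fin N) (Fin N) ℝ)
    (b : (Fin N → ℝ) → Fin N → Fin N → Fin N → ℝ) (K : ℝ)
    (I J : Functional N) : Functional N := fun u =>
  ∫ x : ℝ, ∑ i, varDeriv I u x i * hydroOp g b K u (varDeriv J u) x i

/-- `B` is a Poisson bracket on the class `A` of functionals: `A` is an algebra of functionals
closed under `B`, and `B` is bilinear, skew-symmetric, a derivation in each argument, and satisfies
the Jacobi identity. (Linearity and the Leibniz rule in the second argument follow from those in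
the first by skew symmetry.) -/
structure IsPoissonBracket {N : ℕ} (A : Set (Functional N))
    (B : Functional N → Functional N → Functional N) : Prop where
  add_mem : ∀ I ∈ A, ∀ J ∈ A, I + J ∈ A
  smul_mem : ∀ (r : ℝ), ∀ I ∈ A, r • I ∈ A
  mul_mem : ∀ I ∈ A, ∀ J ∈ A, I * J ∈ A
  bracket_mem : ∀ I ∈ A, ∀ J ∈ A, B I J ∈ A
  add_left : ∀ I ∈ A, ∀ J ∈ A, ∀ L ∈ A, B (I + J) L = B I L + B J L
  smul_left : ∀ (r : ℝ), ∀ I ∈ A, ∀ J ∈ A, B (r • I) J = r • B I J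
  skew : ∀ I ∈ A, ∀ J ∈ A, B I J = -B J I
  leibniz : ∀ I ∈ A, ∀ J ∈ A, ∀ L ∈ A, B (I * J) L = I * B J L + B I L * J
  jacobi : ∀ I ∈ A, ∀ J ∈ A, ∀ L ∈ A, B (B I J) L + B (B J L) I + B (B L I) J = 0

/-- The bracket with coefficients `g`, `b`, `K` is a Poisson bracket on smooth functionals. -/
def IsPoisson {N : ℕ} (g : (Fin N → ℝ) → Matrix (Fin N) (Fin N) ℝ)
    (b : (Fin N → ℝ) → Fin N → Fin N → Fin N → ℝ) (K : ℝ) : Prop :=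
  IsPoissonBracket (smoothFunctionals N) (hydroBracket g b K)

/-! ### The canonical form and its equations -/

/-- The partial derivative `∂f/∂u^k`. -/
def pd {N : ℕ} (k : Fin N) (f : (Fin N → ℝ) → ℝ) (u : Fin N → ℝ) : ℝ :=
  fderiv ℝ f u (Pi.single k 1)

/-- `g^{ij}(u) = η^{is} ∂H^j/∂u^s + η^{js} ∂Hⁱ/∂u^s - K uⁱ u^j`. -/
def canonicalMetric {N : ℕ} (η : Matrix (Fin N) (Fin N) ℝ) (K : ℝ)
    (H : (Fin N → ℝ) → Fin N → ℝ) (u : Fin N → ℝ) : Matrix (Fin N) (Fin N) ℝ :=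
  Matrix.of fun i j => (∑ s, η i s * pd s (fun v => H v j) u)
    + (∑ s, η j s * pd s (fun v => H v i) u) - K * u i * u j

/-- `b^{ij}_k(u) = η^{is} ∂²H^j/∂u^s∂u^k - K δⁱ_k u^j`. -/
def canonicalConnection {N : ℕ} (η : Matrix (Fin N) (Fin N) ℝ) (K : ℝ)
    (H : (Fin N → ℝ) → Fin N → ℝ) (u : Fin N → ℝ) (i j k : Fin N) : ℝ :=
  (∑ s, η i s * pd s (pd k (fun v => H v j)) u) - K * (if i = k then 1 else 0) * u j

/-- The equations
`(∂²Hⁱ/∂u^k∂u^s) η^{sp} (∂²H^j/∂u^p∂u^l) = (∂²H^j/∂u^k∂u^s) η^{sp} (∂²Hⁱ/∂u^p∂u^l)`. -/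
def SolvesFirst {N : ℕ} (η : Matrix (Fin N) (Fin N) ℝ) (H : (Fin N → ℝ) → Fin N → ℝ) : Prop :=
  ∀ (u : Fin N → ℝ) (i j k l : Fin N),
    ∑ s, ∑ p, pd k (pd s (fun v => H v i)) u * η s p * pd p (pd l (fun v => H v j)) u
    = ∑ s, ∑ p, pd k (pd s (fun v => H v j)) u * η s p * pd p (pd l (fun v => H v i)) u

/-- The equations
`(η^{ir} ∂H^s/∂u^r + η^{sr} ∂Hⁱ/∂u^r - K uⁱ u^s) η^{jp} ∂²H^k/∂u^p∂u^s
= (η^{jr} ∂H^s/∂u^r + η^{sr} ∂H^j/∂u^r - K u^j u^s) η^{ip} ∂²H^k/∂u^p∂u^s`. -/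
def SolvesSecond {N : ℕ} (η : Matrix (Fin N) (Fin N) ℝ) (K : ℝ)
    (H : (Fin N → ℝ) → Fin N → ℝ) : Prop :=
  ∀ (u : Fin N → ℝ) (i j k : Fin N),
    ∑ s, ∑ p, canonicalMetric η K H u i s * η j p * pd p (pd s (fun v => H v k)) u
    = ∑ s, ∑ p, canonicalMetric η K H u j s * η i p * pd p (pd s (fun v => H v k)) u

/-! ### Pseudo-Riemannian geometry of a contravariant metric in coordinates -/

/-- The covariant components `g_{ij}`, inverse to `g^{ij}`. -/
def covMetric {N : ℕ} (g : (Fin N → ℝ) → Matrix (Fin N) (Fin N) ℝ) (i j : Fin N)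
    (u : Fin N → ℝ) : ℝ :=
  (g u)⁻¹ i j

/-- The Christoffel symbols of the Levi-Civita connection,
`Γ^j_{sk} = ½ g^{jl} (∂_s g_{lk} + ∂_k g_{ls} - ∂_l g_{sk})`. -/
def christoffel {N : ℕ} (g : (Fin N → ℝ) → Matrix (Fin N) (Fin N) ℝ) (j s k : Fin N)
    (u : Fin N → ℝ) : ℝ :=
  (1 / 2) * ∑ l, g u j l *
    (pd s (covMetric g l k) u + pd k (covMetric g l s) u - pd l (covMetric g s k) u)

/-- The contravariant Levi-Civita symbols `Γ^{ij}_k = g^{is} Γ^j_{sk}`. -/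
def contraChristoffel {N : ℕ} (g : (Fin N → ℝ) → Matrix (Fin N) (Fin N) ℝ) (i j k : Fin N)
    (u : Fin N → ℝ) : ℝ :=
  ∑ s, g u i s * christoffel g j s k u

/-- The Riemann curvature tensor
`Rⁱ_{jkl} = ∂_k Γⁱ_{lj} - ∂_l Γⁱ_{kj} + Γⁱ_{km} Γ^m_{lj} - Γⁱ_{lm} Γ^m_{kj}`. -/
def riemann {N : ℕ} (g : (Fin N → ℝ) → Matrix (Fin N) (Fin N) ℝ) (i j k l : Fin N)
    (u : Fin N → ℝ) : ℝ :=
  pd k (christoffel g i l j) u - pd l (christoffel g i k j) u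
    + ∑ m, (christoffel g i k m u * christoffel g m l j u
      - christoffel g i l m u * christoffel g m k j u)

/-- `g^{ij}` is a (pseudo-Riemannian, contravariant) metric of constant Riemannian curvature `K`
on `Ω`: smooth, symmetric, nondegenerate, and `Rⁱ_{jkl} = K (δⁱ_k g_{jl} - δⁱ_l g_{jk})`. -/
structure IsConstantCurvatureMetricOn {N : ℕ} (g : (Fin N → ℝ) → Matrix (Fin N) (Fin N) ℝ)
    (K : ℝ) (Ω : Set (Fin N → ℝ)) : Prop where
  smooth : ∀ i j, ContDiffOn ℝ ∞ (fun u => g u i j) Ω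
  symm : ∀ u ∈ Ω, (g u).IsSymm
  nondegenerate : ∀ u ∈ Ω, (g u).det ≠ 0
  curvature : ∀ u ∈ Ω, ∀ i j k l : Fin N, riemann g i j k l u
    = K * ((if i = k then 1 else 0) * covMetric g j l u
        - (if i = l then 1 else 0) * covMetric g j k u)

/-- The contravariant tensor `μ^{ij} - K uⁱ u^j`. -/
def quadMetric {N : ℕ} (μ : Matrix (Fin N) (Fin N) ℝ) (K : ℝ) (u : Fin N → ℝ) :
    Matrix (Fin N) (Fin N) ℝ :=
  Matrix.of fun i j => μ i j - K * u i * u j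

/-- The affine functions `Hⁱ(u) = cⁱ_k u^k + cⁱ`; here `c i k` is `cⁱ_k` and `d i` is `cⁱ`. -/
def affineMapH {N : ℕ} (c : Matrix (Fin N) (Fin N) ℝ) (d : Fin N → ℝ) (u : Fin N → ℝ)
    (i : Fin N) : ℝ :=
  (∑ k, c i k * u k) + d i

end HydroBracket

end

noncomputable section

namespace HydroBracket

open MeasureTheory Filter Topology Set

/-! ### Test functions -/

/-! An affine `H` has zero second derivatives, so both systems are trivial and the metric becomes `m
- K uⁱu^j` with `m` a constant symmetric matrix. Since `(d/dx)⁻¹(u^j_x ξ_j) = u^j ξ_j - (d/dx)⁻¹(u^j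
ξ_j')`, the operator equals `m D - K D ∘ u D⁻¹ u ∘ D`, with `D = d/dx` (`hydroOp_eq_hamOp`).
Covectors are constant near the ends, so `ξ'` has compact support and `D⁻¹` is applied only to test
functions.

In this form skew symmetry follows from the symmetry of `m` and the skewness of `D⁻¹`
(`integral_pairing_skew`). Write `G`, `H` for the variational derivatives of `I`, `J`, and `X_I`,
`X_J` for their Hamiltonian fields. Then the variational derivative of `{I,J}` is `G'[X_J] -
H'[X_I]` plus `K (G_i' D⁻¹(u·H') - H_i' D⁻¹(u·G'))`, the last term coming from the dependence of the
operator on `u` (`hasDerivAt_pairing`). In the cyclic sum of the Jacobi identity the second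
variations cancel because they are self-adjoint (`secondVar_symm`), and the explicit terms cancel
pointwise (`explicitVar_pairing_cyclic`). Closure of the algebra reduces to smooth dependence on
parameters: `D⁻¹` and integration over the line are convolutions with locally integrable kernels
(`smooth_convolution`).

For the geometry, put `y_k = g_{kb}u^b`. Differentiating `g^{ab}g_{bk} = δ` gives `∂_s g_{lk} =
K(g_{ls} y_k + y_l g_{sk})`, hence `Γ^j_{sk} = K u^j g_{sk}`. In the curvature only the derivatives
of the factor `u^j` survive. -/

/-- Smooth compactly supported functions on the line. -/
def IsTest (f : ℝ → ℝ) : Prop := ContDiff ℝ ∞ f ∧ HasCompactSupport f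

/-- Smooth functions on the line that equal one constant near both ends. -/
def IsEndConst (f : ℝ → ℝ) : Prop := ContDiff ℝ ∞ f ∧ ∃ a R : ℝ, ∀ x, R < |x| → f x = a

theorem hasCompactSupport_of_bound {f : ℝ → ℝ} {R : ℝ} (h : ∀ x, R < |x| → f x = 0) :
    HasCompactSupport f := by
  refine HasCompactSupport.of_support_subset_isCompact (isCompact_Icc (a := -R) (b := R)) ?_
  intro x hx
  by_contra hc
  exact hx (h x (by by_contra hle; exact hc (abs_le.1 (not_lt.1 hle))))

theorem exists_bound_of_hasCompactSupport {f : ℝ → ℝ} (h : HasCompactSupport f) :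
    ∃ R : ℝ, ∀ x, R < |x| → f x = 0 := by
  obtain ⟨R, hR⟩ := h.isCompact.isBounded.exists_norm_le
  refine ⟨R, fun x hx => ?_⟩
  by_contra hc
  exact absurd (hR x (subset_tsupport f hc)) (not_le.2 hx)

theorem isTest_iff {f : ℝ → ℝ} :
    IsTest f ↔ ContDiff ℝ ∞ f ∧ ∃ R : ℝ, ∀ x, R < |x| → f x = 0 :=
  ⟨fun h => ⟨h.1, exists_bound_of_hasCompactSupport h.2⟩,
    fun ⟨h, _, hR⟩ => ⟨h, hasCompactSupport_of_bound hR⟩⟩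

theorem contDiff_deriv_of_smooth {f : ℝ → ℝ} (hf : ContDiff ℝ ∞ f) : ContDiff ℝ ∞ (deriv f) :=
  (contDiff_infty_iff_deriv.1 hf).2

namespace IsTest

variable {f g : ℝ → ℝ}

theorem continuous (hf : IsTest f) : Continuous f := hf.1.continuous

theorem integrable (hf : IsTest f) : Integrable f :=
  hf.continuous.integrable_of_hasCompactSupport hf.2

theorem hasDerivAt (hf : IsTest f) (x : ℝ) : HasDerivAt f (deriv f x) x :=
  (hf.1.differentiable (by simp) x).hasDerivAt

theorem add (hf : IsTest f) (hg : IsTest g) : IsTest (fun x => f x + g x) :=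
  ⟨hf.1.add hg.1, hf.2.add hg.2⟩

theorem mul_left (hf : ContDiff ℝ ∞ f) (hg : IsTest g) : IsTest (fun x => f x * g x) :=
  ⟨hf.mul hg.1, hg.2.mul_left⟩

theorem mul_right (hf : IsTest f) (hg : ContDiff ℝ ∞ g) : IsTest (fun x => f x * g x) :=
  ⟨hf.1.mul hg, hf.2.mul_right⟩

theorem const_mul (r : ℝ) (hg : IsTest g) : IsTest (fun x => r * g x) :=
  mul_left contDiff_const hg

theorem neg (hf : IsTest f) : IsTest (fun x => - f x) := by
  simpa using hf.const_mul (-1)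

theorem sub (hf : IsTest f) (hg : IsTest g) : IsTest (fun x => f x - g x) := by
  simpa [sub_eq_add_neg] using hf.add hg.neg

theorem zero : IsTest (fun _ => 0) := ⟨contDiff_const, HasCompactSupport.zero⟩

theorem sum {ι : Type*} {s : Finset ι} {f : ι → ℝ → ℝ} (h : ∀ i ∈ s, IsTest (f i)) :
    IsTest (fun x => ∑ i ∈ s, f i x) := by
  classical
  induction s using Finset.induction_on with
  | empty => simpa using zero
  | insert a s ha ih =>
    simp only [Finset.sum_insert ha]
    exact (h a (by simp)).add (ih fun i hi => h i (by simp [hi]))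

theorem deriv (hf : IsTest f) : IsTest (deriv f) := ⟨contDiff_deriv_of_smooth hf.1, hf.2.deriv⟩

theorem integral_deriv (hf : IsTest f) : ∫ x, _root_.deriv f x = 0 := by
  obtain ⟨R, hR⟩ := (isTest_iff.1 hf).2
  have h1 : ∀ᶠ x in atTop, f x = 0 := by
    filter_upwards [eventually_gt_atTop R] with x hx using hR x (lt_of_lt_of_le hx (le_abs_self x))
  have h2 : ∀ᶠ x in atBot, f x = 0 := by
    filter_upwards [eventually_lt_atBot (-R)] with x hx
      using hR x (lt_of_lt_of_le (by linarith) (neg_le_abs x))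
  have := integral_of_hasDerivAt_of_tendsto (f := f) hf.hasDerivAt hf.deriv.integrable
    (m := 0) (n := 0) (tendsto_const_nhds.congr' (h2.mono fun x hx => hx.symm))
    (tendsto_const_nhds.congr' (h1.mono fun x hx => hx.symm))
  simpa using this

end IsTest

namespace IsEndConst

variable {f g : ℝ → ℝ}

theorem hasDerivAt (hf : IsEndConst f) (x : ℝ) : HasDerivAt f (deriv f x) x :=
  (hf.1.differentiable (by simp) x).hasDerivAt

theorem mul (hf : IsEndConst f) (hg : IsEndConst g) : IsEndConst (fun x => f x * g x) := by
  obtain ⟨a, R, h⟩ := hf.2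
  obtain ⟨b, S, h'⟩ := hg.2
  exact ⟨hf.1.mul hg.1, a * b, max R S, fun x hx => by
    beta_reduce
    rw [h x (lt_of_le_of_lt (le_max_left _ _) hx), h' x (lt_of_le_of_lt (le_max_right _ _) hx)]⟩

theorem exists_test (hf : IsEndConst f) : ∃ a, IsTest (fun x => f x - a) := by
  obtain ⟨a, R, h⟩ := hf.2
  exact ⟨a, isTest_iff.2 ⟨hf.1.sub contDiff_const, R, fun x hx => by simp [h x hx]⟩⟩

theorem deriv (hf : IsEndConst f) : IsTest (deriv f) := by
  obtain ⟨a, h⟩ := hf.exists_test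
  have := h.deriv
  rwa [show _root_.deriv (fun x => f x - a) = _root_.deriv f from
    funext fun x => deriv_sub_const a] at this

/-- The two boundary terms cancel because the constant is the same at both ends. -/
theorem integral_deriv (hf : IsEndConst f) : ∫ x, _root_.deriv f x = 0 := by
  obtain ⟨a, h⟩ := hf.exists_test
  have := h.integral_deriv
  rwa [show _root_.deriv (fun x => f x - a) = _root_.deriv f from
    funext fun x => deriv_sub_const a] at this

end IsEndConst

/-! ### The operator `(d/dx)⁻¹` -/

theorem invD_eq {f : ℝ → ℝ} (hf : Integrable f) (x : ℝ) :
    invD f x = (∫ y in Iic x, f y) - (1 / 2) * ∫ y, f y := by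
  have := integral_add_compl (s := Iic x) measurableSet_Iic hf
  rw [compl_Iic] at this
  rw [invD, ← this]
  ring

theorem invD_add {f g : ℝ → ℝ} (hf : Integrable f) (hg : Integrable g) (x : ℝ) :
    invD (fun y => f y + g y) x = invD f x + invD g x := by
  rw [invD_eq hf, invD_eq hg, invD_eq (f := fun y => f y + g y) (hf.add hg),
    integral_add hf hg,
    integral_add hf.integrableOn hg.integrableOn]
  ring

theorem invD_sub {f g : ℝ → ℝ} (hf : Integrable f) (hg : Integrable g) (x : ℝ) :
    invD (fun y => f y - g y) x = invD f x - invD g x := by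
  rw [invD_eq hf, invD_eq hg, invD_eq (f := fun y => f y - g y) (hf.sub hg),
    integral_sub hf hg,
    integral_sub hf.integrableOn hg.integrableOn]
  ring

theorem invD_sum {ι : Type*} (s : Finset ι) {f : ι → ℝ → ℝ} (h : ∀ i ∈ s, Integrable (f i))
    (x : ℝ) : invD (fun y => ∑ i ∈ s, f i y) x = ∑ i ∈ s, invD (f i) x := by
  simp only [invD]
  rw [integral_finsetSum _ fun i hi => (h i hi).integrableOn,
    integral_finsetSum _ fun i hi => (h i hi).integrableOn, ← Finset.sum_sub_distrib,
    Finset.mul_sum]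

theorem invD_deriv {f : ℝ → ℝ} (hf : IsTest f) (x : ℝ) : invD (deriv f) x = f x := by
  have h1 : ContDiff ℝ 1 f := hf.1.of_le (by exact_mod_cast le_top)
  rw [invD, hf.2.integral_Iic_deriv_eq h1, hf.2.integral_Ioi_deriv_eq h1]
  ring

theorem hasDerivAt_invD {f : ℝ → ℝ} (hf : IsTest f) (x : ℝ) : HasDerivAt (invD f) (f x) x := by
  have hi := hf.integrable
  have h : ∀ y, invD f y = (∫ z in (0 : ℝ)..y, f z) + invD f 0 := fun y => by
    rw [invD_eq hi, invD_eq hi,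
      ← intervalIntegral.integral_Iic_sub_Iic hi.integrableOn hi.integrableOn]
    ring
  rw [show invD f = fun y => (∫ z in (0 : ℝ)..y, f z) + invD f 0 from funext h]
  exact (hf.continuous.integral_hasStrictDerivAt 0 x).hasDerivAt.add_const _

theorem deriv_invD {f : ℝ → ℝ} (hf : IsTest f) : deriv (invD f) = f :=
  funext fun x => (hasDerivAt_invD hf x).deriv

theorem contDiff_invD {f : ℝ → ℝ} (hf : IsTest f) : ContDiff ℝ ∞ (invD f) :=
  contDiff_infty_iff_deriv.2
    ⟨fun x => (hasDerivAt_invD hf x).differentiableAt, by rw [deriv_invD hf]; exact hf.1⟩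

theorem exists_invD_ends {f : ℝ → ℝ} (hf : IsTest f) :
    ∃ R : ℝ, (∀ x, R < x → invD f x = (1 / 2) * ∫ y, f y) ∧
      ∀ x, x < -R → invD f x = -((1 / 2) * ∫ y, f y) := by
  obtain ⟨R, hR⟩ := (isTest_iff.1 hf).2
  refine ⟨R, fun x hx => ?_, fun x hx => ?_⟩
  · have h0 : ∫ y in Ioi x, f y = 0 := by
      rw [setIntegral_congr_fun (g := fun _ => (0 : ℝ)) measurableSet_Ioi fun y hy =>
        hR y (lt_of_lt_of_le (lt_trans hx hy) (le_abs_self y))]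
      simp
    have := integral_add_compl (s := Iic x) measurableSet_Iic hf.integrable
    rw [compl_Iic, h0] at this
    rw [invD, h0, ← this]
    ring
  · have h0 : ∫ y in Iic x, f y = 0 := by
      rw [setIntegral_congr_fun (g := fun _ => (0 : ℝ)) measurableSet_Iic fun y hy =>
        hR y (lt_of_lt_of_le (by have : y ≤ x := hy; linarith) (neg_le_abs y))]
      simp
    rw [invD_eq hf.integrable, h0]
    ring

/-- The integrand of the sum of both sides is the derivative of `invD f * invD g`. Each factor tends
to opposite values at the two ends, so the product takes the same value at both. -/
theorem integral_mul_invD_skew {f g : ℝ → ℝ} (hf : IsTest f) (hg : IsTest g) :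
    ∫ x, f x * invD g x = - ∫ x, g x * invD f x := by
  have hd : ∀ x, HasDerivAt (fun y => invD f y * invD g y)
      (f x * invD g x + invD f x * g x) x :=
    fun x => (hasDerivAt_invD hf x).mul (hasDerivAt_invD hg x)
  obtain ⟨R, hR, hR'⟩ := exists_invD_ends hf
  obtain ⟨S, hS, hS'⟩ := exists_invD_ends hg
  have hE : IsEndConst (fun y => invD f y * invD g y) := by
    refine ⟨(contDiff_invD hf).mul (contDiff_invD hg),
      ((1 / 2) * ∫ y, f y) * ((1 / 2) * ∫ y, g y), max R S, fun x hx => ?_⟩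
    have h1 := lt_of_le_of_lt (le_max_left R S) hx
    have h2 := lt_of_le_of_lt (le_max_right R S) hx
    rcases abs_cases x with ⟨hx', -⟩ | ⟨hx', -⟩ <;>
      rw [hx'] at h1 h2 <;> beta_reduce
    · rw [hR x h1, hS x h2]
    · rw [hR' x (by linarith), hS' x (by linarith)]
      ring
  have h0 := hE.integral_deriv
  rw [show deriv (fun y => invD f y * invD g y) = fun x => f x * invD g x + g x * invD f x from
    funext fun x => by rw [(hd x).deriv]; ring,
    integral_add (hf.mul_right (contDiff_invD hg)).integrable
      (hg.mul_right (contDiff_invD hf)).integrable] at h0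
  linarith

/-! ### Smooth families of functions on the line -/

section Families

variable {E E' : Type*} [NormedAddCommGroup E] [NormedSpace ℝ E] [NormedAddCommGroup E']
  [NormedSpace ℝ E']

/-- A jointly smooth family of functions on the line, with supports that are compact locally
uniformly in the parameter. -/
structure SmoothTestFamily (f : E → ℝ → ℝ) : Prop where
  smooth : ContDiff ℝ ∞ (fun p : E × ℝ => f p.1 p.2)
  support : ∀ S : Set E, IsCompact S → ∃ R : ℝ, ∀ t ∈ S, ∀ x : ℝ, R < |x| → f t x = 0

/-- A jointly smooth family of functions on the line, each equal to one constant near both ends,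
off a compact set that is locally uniform in the parameter. -/
structure SmoothEndFamily (f : E → ℝ → ℝ) : Prop where
  smooth : ContDiff ℝ ∞ (fun p : E × ℝ => f p.1 p.2)
  constant : ∀ S : Set E, IsCompact S →
    ∃ R : ℝ, ∀ t ∈ S, ∃ a : ℝ, ∀ x : ℝ, R < |x| → f t x = a

theorem contDiff_slice {f : E → ℝ → ℝ} (hf : ContDiff ℝ ∞ (fun p : E × ℝ => f p.1 p.2)) (t : E) :
    ContDiff ℝ ∞ (f t) :=
  hf.comp (contDiff_const.prodMk contDiff_id : ContDiff ℝ ∞ fun x : ℝ => (t, x))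

theorem contDiff_deriv_snd {f : E → ℝ → ℝ} (hf : ContDiff ℝ ∞ (fun p : E × ℝ => f p.1 p.2)) :
    ContDiff ℝ ∞ (fun p : E × ℝ => deriv (f p.1) p.2) := by
  have h : (fun p : E × ℝ => deriv (f p.1) p.2)
      = fun p => fderiv ℝ (fun q : E × ℝ => f q.1 q.2) p (0, 1) := by
    funext p
    have h1 := (hf.differentiable (by simp) p).hasFDerivAt
    have h2 : HasDerivAt (fun x : ℝ => (p.1, x)) ((0 : E), (1 : ℝ)) p.2 :=
      (hasDerivAt_const _ _).prodMk (hasDerivAt_id _)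
    exact (h1.comp_hasDerivAt p.2 h2).deriv
  rw [h]
  exact (hf.fderiv_right (m := ∞) (by simp)).clm_apply contDiff_const

theorem hasDerivAt_param {f : E × ℝ → ℝ → ℝ}
    (hf : ContDiff ℝ ∞ (fun p : (E × ℝ) × ℝ => f p.1 p.2)) (t : E) (s x : ℝ) :
    HasDerivAt (fun ε => f (t, ε) x)
      (fderiv ℝ (fun q : (E × ℝ) × ℝ => f q.1 q.2) ((t, s), x) ((0, 1), 0)) s := by
  have h1 := (hf.differentiable (by simp) ((t, s), x)).hasFDerivAt
  have h2 : HasDerivAt (fun ε : ℝ => ((t, ε), x)) (((0 : E), (1 : ℝ)), (0 : ℝ)) s :=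
    ((hasDerivAt_const _ _).prodMk (hasDerivAt_id _)).prodMk (hasDerivAt_const _ _)
  exact h1.comp_hasDerivAt s h2

theorem contDiff_deriv_param {f : E × ℝ → ℝ → ℝ}
    (hf : ContDiff ℝ ∞ (fun p : (E × ℝ) × ℝ => f p.1 p.2)) :
    ContDiff ℝ ∞ (fun p : E × ℝ => deriv (fun ε => f (p.1, ε) p.2) 0) := by
  have h : (fun p : E × ℝ => deriv (fun ε => f (p.1, ε) p.2) 0)
      = fun p => fderiv ℝ (fun q : (E × ℝ) × ℝ => f q.1 q.2) ((p.1, 0), p.2) ((0, 1), 0) :=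
    funext fun p => (hasDerivAt_param hf p.1 0 p.2).deriv
  rw [h]
  refine ContDiff.clm_apply ((hf.fderiv_right (m := ∞) (by simp)).comp ?_) contDiff_const
  exact (contDiff_fst.prodMk contDiff_const).prodMk contDiff_snd

/-- Serves twice: to exchange a variation with `d/dx`, and to make the second variation symmetric.
-/
theorem deriv_deriv_comm {φ : ℝ → ℝ → ℝ} (hφ : ContDiff ℝ ∞ (fun p : ℝ × ℝ => φ p.1 p.2))
    (a b : ℝ) :
    deriv (fun s => deriv (fun t => φ s t) b) a = deriv (fun t => deriv (fun s => φ s t) a) b := by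
  set F : ℝ × ℝ → ℝ := fun p => φ p.1 p.2 with hF
  have hd : ∀ p, HasFDerivAt F (fderiv ℝ F p) p :=
    fun p => (hφ.differentiable (by simp) p).hasFDerivAt
  have hd2 : ∀ p, HasFDerivAt (fderiv ℝ F) (fderiv ℝ (fderiv ℝ F) p) p := fun p =>
    (((hφ.fderiv_right (m := ∞) (by simp)).differentiable (by simp)) p).hasFDerivAt
  have e1 : ∀ s t, HasDerivAt (fun t : ℝ => (s, t)) ((0 : ℝ), (1 : ℝ)) t := fun s t =>
    (hasDerivAt_const _ _).prodMk (hasDerivAt_id _)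
  have e2 : ∀ s t, HasDerivAt (fun s : ℝ => (s, t)) ((1 : ℝ), (0 : ℝ)) s := fun s t =>
    (hasDerivAt_id _).prodMk (hasDerivAt_const _ _)
  have k : ∀ (v w : ℝ × ℝ) (γ : ℝ → ℝ × ℝ) (r : ℝ), HasDerivAt γ v r →
      HasDerivAt (fun s => fderiv ℝ F (γ s) w) (fderiv ℝ (fderiv ℝ F) (γ r) v w) r := by
    intro v w γ r hγ
    have h := ((hd2 (γ r)).comp_hasDerivAt r hγ).clm_apply (hasDerivAt_const r w)
    rwa [map_zero, add_zero] at h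
  have h1 : ∀ s, deriv (fun t => φ s t) b = fderiv ℝ F (s, b) (0, 1) := fun s =>
    ((hd (s, b)).comp_hasDerivAt (f := fun t => (s, t)) b (e1 s b)).deriv
  have h2 : ∀ t, deriv (fun s => φ s t) a = fderiv ℝ F (a, t) (1, 0) := fun t =>
    ((hd (a, t)).comp_hasDerivAt (f := fun s => (s, t)) a (e2 a t)).deriv
  simp only [h1, h2]
  rw [(k _ (0, 1) (fun s => (s, b)) a (e2 a b)).deriv,
    (k _ (1, 0) (fun t => (a, t)) b (e1 a b)).deriv]
  exact (hφ.contDiffAt (x := (a, b))).isSymmSndFDerivAt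
    (by rw [minSmoothness_of_isRCLikeNormedField]
        exact WithTop.coe_le_coe.2 (le_top : (2 : ℕ∞) ≤ ⊤)) _ _

namespace SmoothTestFamily

variable {f g : E → ℝ → ℝ}

theorem isTest (hf : SmoothTestFamily f) (t : E) : IsTest (f t) := by
  obtain ⟨R, hR⟩ := hf.support {t} isCompact_singleton
  exact isTest_iff.2 ⟨contDiff_slice hf.smooth t, R, hR t rfl⟩

theorem add (hf : SmoothTestFamily f) (hg : SmoothTestFamily g) :
    SmoothTestFamily (fun t x => f t x + g t x) := by
  refine ⟨hf.smooth.add hg.smooth, fun S hS => ?_⟩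
  obtain ⟨R, hR⟩ := hf.support S hS
  obtain ⟨R', hR'⟩ := hg.support S hS
  refine ⟨max R R', fun t ht x hx => ?_⟩
  rw [hR t ht x (lt_of_le_of_lt (le_max_left _ _) hx),
    hR' t ht x (lt_of_le_of_lt (le_max_right _ _) hx), add_zero]

theorem mul_left (hf : ContDiff ℝ ∞ (fun p : E × ℝ => f p.1 p.2)) (hg : SmoothTestFamily g) :
    SmoothTestFamily (fun t x => f t x * g t x) := by
  refine ⟨hf.mul hg.smooth, fun S hS => ?_⟩
  obtain ⟨R, hR⟩ := hg.support S hS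
  exact ⟨R, fun t ht x hx => by rw [hR t ht x hx, mul_zero]⟩

theorem mul_right (hf : SmoothTestFamily f) (hg : ContDiff ℝ ∞ (fun p : E × ℝ => g p.1 p.2)) :
    SmoothTestFamily (fun t x => f t x * g t x) := by
  simpa only [mul_comm] using mul_left hg hf

theorem const_mul (r : ℝ) (hg : SmoothTestFamily g) : SmoothTestFamily (fun t x => r * g t x) :=
  mul_left contDiff_const hg

theorem sub (hf : SmoothTestFamily f) (hg : SmoothTestFamily g) :
    SmoothTestFamily (fun t x => f t x - g t x) := by
  simpa [sub_eq_add_neg] using hf.add (hg.const_mul (-1))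

theorem sum {ι : Type*} {s : Finset ι} {f : ι → E → ℝ → ℝ} (h : ∀ i, SmoothTestFamily (f i)) :
    SmoothTestFamily (fun t x => ∑ i ∈ s, f i t x) := by
  classical
  induction s using Finset.induction_on with
  | empty => exact ⟨by simpa using contDiff_const, fun S _ => ⟨0, by simp⟩⟩
  | insert a s ha ih =>
    simp only [Finset.sum_insert ha]
    exact (h a).add ih

theorem comp (hf : SmoothTestFamily f) {φ : E' → E} (hφ : ContDiff ℝ ∞ φ) :
    SmoothTestFamily (fun t => f (φ t)) := by
  refine ⟨hf.smooth.comp ((hφ.comp contDiff_fst).prodMk contDiff_snd), fun S hS => ?_⟩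
  obtain ⟨R, hR⟩ := hf.support (φ '' S) (hS.image hφ.continuous)
  exact ⟨R, fun t ht => hR _ (mem_image_of_mem _ ht)⟩

/-- Smoothness is local in the parameter. Over a closed unit ball, compact because `E` is proper,
all supports lie in one interval, so the convolution theorem with parameters applies. -/
theorem smooth_convolution [ProperSpace E] (hf : SmoothTestFamily f) {k : ℝ → ℝ}
    (hk : LocallyIntegrable k) :
    ContDiff ℝ ∞ (fun p : E × ℝ => ∫ y, k (p.2 - y) * f p.1 y) := by
  rw [contDiff_iff_contDiffAt]
  rintro ⟨t, x⟩
  obtain ⟨R, hR⟩ := hf.support (Metric.closedBall t 1) (isCompact_closedBall t 1)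
  have h := contDiffOn_convolution_right_with_param (𝕜 := ℝ) (μ := volume) (n := ⊤) (f := k)
    (ContinuousLinearMap.mul ℝ ℝ) (g := f) (s := Metric.ball t 1) (k := Icc (-R) R)
    Metric.isOpen_ball isCompact_Icc
    (fun p y hp hy => hR p (Metric.ball_subset_closedBall hp) y
      (by by_contra hle; exact hy (abs_le.1 (not_lt.1 hle)))) hk hf.smooth.contDiffOn
  have h' := h.contDiffAt (x := (t, x))
    ((Metric.isOpen_ball.prod isOpen_univ).mem_nhds ⟨Metric.mem_ball_self one_pos, mem_univ _⟩)
  refine h'.congr_of_eventuallyEq (Eventually.of_forall fun p => ?_)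
  simp [convolution_eq_swap]

theorem smooth_invD [ProperSpace E] (hf : SmoothTestFamily f) :
    ContDiff ℝ ∞ (fun p : E × ℝ => invD (f p.1) p.2) := by
  -- `invD` is convolution with half the sign function; the value at `0` matches the split into
  -- `Iic` and `Ioi`.
  have hk : LocallyIntegrable (fun y : ℝ => if 0 ≤ y then (1 / 2 : ℝ) else -(1 / 2)) := by
    refine LocallyIntegrable.mono (locallyIntegrable_const (1 : ℝ)) ?_ ?_
    · exact (Measurable.ite measurableSet_Ici measurable_const
        measurable_const).aestronglyMeasurable
    · refine Eventually.of_forall fun y => ?_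
      split_ifs <;> norm_num
  convert hf.smooth_convolution hk using 2 with p
  have hi := (hf.isTest p.1).integrable
  have h1 : Integrable fun y => (if 0 ≤ p.2 - y then (1 / 2 : ℝ) else -(1 / 2)) * f p.1 y := by
    refine hi.bdd_mul (c := 1) ?_ (Eventually.of_forall fun y => ?_)
    · exact (Measurable.ite (measurableSet_le measurable_const (measurable_const.sub measurable_id))
        measurable_const measurable_const).aestronglyMeasurable
    · split_ifs <;> norm_num
  rw [← integral_add_compl (s := Iic p.2) measurableSet_Iic h1, compl_Iic,
    setIntegral_congr_fun (g := fun y => (1 / 2) * f p.1 y) measurableSet_Iic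
      (fun y (hy : y ≤ p.2) => by simp [hy]),
    setIntegral_congr_fun (s := Ioi p.2) (g := fun y => -(1 / 2) * f p.1 y) measurableSet_Ioi
      (fun y (hy : p.2 < y) => by simp [hy]),
    integral_const_mul, integral_const_mul, invD]
  ring

/-- The integral is the convolution with the constant `1`, evaluated at the point `0`. -/
theorem smooth_integral [ProperSpace E] (hf : SmoothTestFamily f) :
    ContDiff ℝ ∞ (fun t => ∫ x, f t x) := by
  have h := (hf.smooth_convolution (locallyIntegrable_const (1 : ℝ))).comp
    (contDiff_id.prodMk contDiff_const : ContDiff ℝ ∞ fun t : E => (t, (0 : ℝ)))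
  simpa [Function.comp_def] using h

/-- For parameters in `[-1, 1]` the derivative vanishes off `[-R, R]` and is bounded by continuity
on the compact box, which gives the dominating function. A general `s` covers both half-lines in
`invD`. -/
theorem hasDerivAt_setIntegral {f : ℝ → ℝ → ℝ} (hf : SmoothTestFamily f) {s : Set ℝ} :
    HasDerivAt (fun ε => ∫ x in s, f ε x) (∫ x in s, deriv (fun ε => f ε x) 0) 0 := by
  obtain ⟨R, hR⟩ := hf.support (Icc (-1) 1) isCompact_Icc
  have hd : ContDiff ℝ ∞ (fun p : ℝ × ℝ => deriv (fun ε => f ε p.2) p.1) := by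
    have h := contDiff_deriv_snd (E := ℝ) (f := fun x ε => f ε x)
      (hf.smooth.comp (contDiff_snd.prodMk contDiff_fst))
    exact h.comp (contDiff_snd.prodMk contDiff_fst)
  obtain ⟨C, hC⟩ := (isCompact_Icc.prod isCompact_Icc : IsCompact
    (Icc (-1 : ℝ) 1 ×ˢ Icc (-R) R)).exists_bound_of_continuousOn hd.continuous.continuousOn
  have hz : ∀ ε ∈ Ioo (-1 : ℝ) 1, ∀ x, x ∉ Icc (-R) R → deriv (fun ε => f ε x) ε = 0 := by
    intro ε hε x hx
    have : (fun ε => f ε x) =ᶠ[𝓝 ε] fun _ => 0 := by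
      filter_upwards [Ioo_mem_nhds hε.1 hε.2] with δ hδ
      exact hR δ (Ioo_subset_Icc_self hδ) x (by by_contra hle; exact hx (abs_le.1 (not_lt.1 hle)))
    rw [this.deriv_eq, deriv_const]
  refine (hasDerivAt_integral_of_dominated_loc_of_deriv_le (μ := volume.restrict s)
    (F := f) (F' := fun ε x => deriv (fun ε => f ε x) ε) (s := Ioo (-1) 1)
    (bound := (Icc (-R) R).indicator fun _ => C)
    (Ioo_mem_nhds (by norm_num) (by norm_num)) ?_ ?_ ?_ ?_ ?_ ?_).2
  · exact Eventually.of_forall fun ε => (hf.isTest ε).continuous.aestronglyMeasurable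
  · exact (hf.isTest 0).integrable.integrableOn
  · exact (contDiff_slice (f := fun ε x => deriv (fun ε => f ε x) ε) hd
      0).continuous.aestronglyMeasurable
  · refine Eventually.of_forall fun x ε hε => ?_
    by_cases hx : x ∈ Icc (-R) R
    · rw [indicator_of_mem hx]
      exact hC (ε, x) ⟨Ioo_subset_Icc_self hε, hx⟩
    · rw [indicator_of_notMem hx, hz ε hε x hx, norm_zero]
  · refine Integrable.integrableOn ((integrable_indicator_iff measurableSet_Icc).2 ?_)
    exact integrableOn_const (by simp) (by simp)
  · refine Eventually.of_forall fun x ε _ => ?_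
    exact ((hf.smooth.comp (contDiff_id.prodMk contDiff_const)).differentiable
      (by simp) ε : DifferentiableAt ℝ (fun ε => f ε x) ε).hasDerivAt

theorem hasDerivAt_integral {f : ℝ → ℝ → ℝ} (hf : SmoothTestFamily f) :
    HasDerivAt (fun ε => ∫ x, f ε x) (∫ x, deriv (fun ε => f ε x) 0) 0 := by
  simpa using hf.hasDerivAt_setIntegral (s := univ)

theorem hasDerivAt_invD_param {f : ℝ → ℝ → ℝ} (hf : SmoothTestFamily f) (x : ℝ) :
    HasDerivAt (fun ε => invD (f ε) x) (invD (fun y => deriv (fun ε => f ε y) 0) x) 0 :=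
  (hf.hasDerivAt_setIntegral.sub hf.hasDerivAt_setIntegral).const_mul _

end SmoothTestFamily

namespace SmoothEndFamily

variable {f g : E → ℝ → ℝ}

theorem isEndConst (hf : SmoothEndFamily f) (t : E) : IsEndConst (f t) := by
  obtain ⟨R, hR⟩ := hf.constant {t} isCompact_singleton
  obtain ⟨a, ha⟩ := hR t rfl
  exact ⟨contDiff_slice hf.smooth t, a, R, ha⟩

theorem of_test (hf : SmoothTestFamily f) : SmoothEndFamily f := by
  refine ⟨hf.smooth, fun S hS => ?_⟩
  obtain ⟨R, hR⟩ := hf.support S hS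
  exact ⟨R, fun t ht => ⟨0, hR t ht⟩⟩

theorem add (hf : SmoothEndFamily f) (hg : SmoothEndFamily g) :
    SmoothEndFamily (fun t x => f t x + g t x) := by
  refine ⟨hf.smooth.add hg.smooth, fun S hS => ?_⟩
  obtain ⟨R, hR⟩ := hf.constant S hS
  obtain ⟨R', hR'⟩ := hg.constant S hS
  refine ⟨max R R', fun t ht => ?_⟩
  obtain ⟨a, ha⟩ := hR t ht
  obtain ⟨b, hb⟩ := hR' t ht
  exact ⟨a + b, fun x hx => by
    rw [ha x (lt_of_le_of_lt (le_max_left _ _) hx), hb x (lt_of_le_of_lt (le_max_right _ _) hx)]⟩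

theorem param_mul {φ : E → ℝ} (hφ : ContDiff ℝ ∞ φ) (hf : SmoothEndFamily f) :
    SmoothEndFamily (fun t x => φ t * f t x) := by
  refine ⟨(hφ.comp contDiff_fst).mul hf.smooth, fun S hS => ?_⟩
  obtain ⟨R, hR⟩ := hf.constant S hS
  refine ⟨R, fun t ht => ?_⟩
  obtain ⟨a, ha⟩ := hR t ht
  exact ⟨φ t * a, fun x hx => by rw [ha x hx]⟩

theorem sub (hf : SmoothEndFamily f) (hg : SmoothEndFamily g) :
    SmoothEndFamily (fun t x => f t x - g t x) := by
  simpa [sub_eq_add_neg] using hf.add (hg.param_mul (φ := fun _ => -1) contDiff_const)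

theorem comp (hf : SmoothEndFamily f) {φ : E' → E} (hφ : ContDiff ℝ ∞ φ) :
    SmoothEndFamily (fun t => f (φ t)) := by
  refine ⟨hf.smooth.comp ((hφ.comp contDiff_fst).prodMk contDiff_snd), fun S hS => ?_⟩
  obtain ⟨R, hR⟩ := hf.constant (φ '' S) (hS.image hφ.continuous)
  exact ⟨R, fun t ht => hR _ (mem_image_of_mem _ ht)⟩

theorem deriv_snd (hf : SmoothEndFamily f) : SmoothTestFamily (fun t x => deriv (f t) x) := by
  refine ⟨contDiff_deriv_snd hf.smooth, fun S hS => ?_⟩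
  obtain ⟨R, hR⟩ := hf.constant S hS
  refine ⟨R, fun t ht x hx => ?_⟩
  obtain ⟨a, ha⟩ := hR t ht
  have : f t =ᶠ[𝓝 x] fun _ => a := by
    filter_upwards [(isOpen_lt continuous_const continuous_abs).mem_nhds hx] with y hy
    exact ha y hy
  rw [this.deriv_eq, deriv_const]

/-- The end constant is not assumed differentiable in the parameter. Instead, for `ε` near `0` the
values at `x` and at one fixed far point agree, so their derivatives in `ε` agree too. -/
theorem deriv_param {f : E × ℝ → ℝ → ℝ} (hf : SmoothEndFamily f) :
    SmoothEndFamily (fun t x => deriv (fun ε => f (t, ε) x) 0) := by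
  refine ⟨contDiff_deriv_param hf.smooth, fun S hS => ?_⟩
  obtain ⟨R, hR⟩ := hf.constant (S ×ˢ Icc (-1) 1) (hS.prod isCompact_Icc)
  -- The reference point `|R| + 1` lies beyond `R` whatever the sign of `R`.
  have hR0 : R < |(|R| + 1)| := by
    rw [abs_of_pos (by positivity)]
    linarith [le_abs_self R]
  refine ⟨R, fun t ht => ⟨deriv (fun ε => f (t, ε) (|R| + 1)) 0, fun x hx => ?_⟩⟩
  refine Filter.EventuallyEq.deriv_eq ?_
  filter_upwards [Icc_mem_nhds (show (-1 : ℝ) < 0 by norm_num) one_pos] with ε hε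
  obtain ⟨a, ha⟩ := hR (t, ε) ⟨ht, hε⟩
  rw [ha x hx, ha _ hR0]

end SmoothEndFamily

end Families

/-! ### Families of fields over finite-dimensional parameter spaces -/

section Variational

variable {E : Type*} [NormedAddCommGroup E] [NormedSpace ℝ E] {N k : ℕ}

theorem isSmoothFieldFamily_iff {c : (Fin k → ℝ) → fieldSpace N} :
    IsSmoothFieldFamily c ↔
      ∀ i, SmoothTestFamily (fun t x => (c t : ℝ → Fin N → ℝ) x i) := by
  constructor
  · intro h i
    refine ⟨contDiff_pi.1 h.smooth i, fun S hS => ?_⟩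
    obtain ⟨R, hR⟩ := h.support S hS
    exact ⟨R, fun t ht x hx => by rw [hR t ht x hx]; rfl⟩
  · intro h
    refine ⟨contDiff_pi.2 fun i => (h i).smooth, fun S hS => ?_⟩
    choose R hR using fun i => (h i).support S hS
    obtain ⟨M, hM⟩ := (Set.finite_range R).bddAbove
    exact ⟨M, fun t ht x hx => funext fun i =>
      hR i t ht x (lt_of_le_of_lt (hM (mem_range_self i)) hx)⟩

theorem isSmoothCovectorFamily_iff {ξ : (Fin k → ℝ) → ℝ → Fin N → ℝ} :
    IsSmoothCovectorFamily ξ ↔ ∀ i, SmoothEndFamily (fun t x => ξ t x i) := by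
  constructor
  · intro h i
    refine ⟨contDiff_pi.1 h.smooth i, fun S hS => ?_⟩
    obtain ⟨R, hR⟩ := h.constant S hS
    refine ⟨R, fun t ht => ?_⟩
    obtain ⟨a, ha⟩ := hR t ht
    exact ⟨a i, fun x hx => by rw [ha x hx]⟩
  · intro h
    refine ⟨contDiff_pi.2 fun i => (h i).smooth, fun S hS => ?_⟩
    choose R hR using fun i => (h i).constant S hS
    obtain ⟨M, hM⟩ := (Set.finite_range R).bddAbove
    refine ⟨M, fun t ht => ?_⟩
    choose a ha using fun i => hR i t ht
    exact ⟨a, fun x hx => funext fun i => ha i x (lt_of_le_of_lt (hM (mem_range_self i)) hx)⟩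

theorem field_isTest (u : fieldSpace N) (i : Fin N) :
    IsTest (fun x => (u : ℝ → Fin N → ℝ) x i) :=
  ⟨contDiff_pi.1 u.2.1 i, u.2.2.comp_left (g := fun y : Fin N → ℝ => y i) rfl⟩

/-- The field with given test functions as components. -/
def mkField (w : ℝ → Fin N → ℝ) (h : ∀ i, IsTest (fun x => w x i)) : fieldSpace N :=
  ⟨w, contDiff_pi.2 fun i => (h i).1, by
    choose R hR using fun i => exists_bound_of_hasCompactSupport (h i).2
    obtain ⟨M, hM⟩ := (Set.finite_range R).bddAbove
    refine HasCompactSupport.of_support_subset_isCompact (isCompact_Icc (a := -M) (b := M)) ?_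
    intro x hx
    by_contra hc
    refine hx (funext fun i => hR i x (lt_of_le_of_lt (hM (mem_range_self i)) ?_))
    by_contra hle
    exact hc (abs_le.1 (not_lt.1 hle))⟩

theorem smoothTestFamily_const {f : ℝ → ℝ} (hf : IsTest f) :
    SmoothTestFamily (fun (_ : E) => f) := by
  obtain ⟨R, hR⟩ := exists_bound_of_hasCompactSupport hf.2
  exact ⟨hf.1.comp contDiff_snd, fun _ _ => ⟨R, fun _ _ => hR⟩⟩

/-- Adjoining the line parameter to `E` turns a variation of a family into an ordinary family over
`E × ℝ`. -/
theorem smoothTestFamily_line {c w : E → fieldSpace N}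
    (hc : ∀ i, SmoothTestFamily (fun t x => (c t : ℝ → Fin N → ℝ) x i))
    (hw : ∀ i, SmoothTestFamily (fun t x => (w t : ℝ → Fin N → ℝ) x i)) (i : Fin N) :
    SmoothTestFamily
      (fun (p : E × ℝ) x => ((c p.1 + p.2 • w p.1 : fieldSpace N) : ℝ → Fin N → ℝ) x i) :=
  ((hc i).comp contDiff_fst).add
    (SmoothTestFamily.mul_left (f := fun (p : E × ℝ) _ => p.2) (contDiff_snd.comp contDiff_fst)
      ((hw i).comp (φ := (Prod.fst : E × ℝ → E)) contDiff_fst))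

/-! ### Variational derivatives: families, uniqueness and algebra operations. -/

namespace HasVarDeriv

variable {I J : Functional N} {G H : fieldSpace N → ℝ → Fin N → ℝ}

/-- Linear coordinates carry the definition from `Fin k → ℝ` to any finite-dimensional parameter
space, in particular to products such as `E × ℝ`. -/
theorem contDiff_family [FiniteDimensional ℝ E] (h : HasVarDeriv I G) {c : E → fieldSpace N}
    (hc : ∀ i, SmoothTestFamily (fun t x => (c t : ℝ → Fin N → ℝ) x i)) :
    ContDiff ℝ ∞ (fun t => I (c t)) := by
  let e : E ≃L[ℝ] (Fin (Module.finrank ℝ E) → ℝ) := ContinuousLinearEquiv.ofFinrankEq (by simp)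
  have h1 := h.smooth _ (fun t => c (e.symm t))
    (isSmoothFieldFamily_iff.2 fun i => (hc i).comp e.symm.contDiff)
  simpa [Function.comp_def] using h1.comp e.contDiff

theorem endFamily [FiniteDimensional ℝ E] (h : HasVarDeriv I G) {c : E → fieldSpace N}
    (hc : ∀ i, SmoothTestFamily (fun t x => (c t : ℝ → Fin N → ℝ) x i)) (i : Fin N) :
    SmoothEndFamily (fun t x => G (c t) x i) := by
  let e : E ≃L[ℝ] (Fin (Module.finrank ℝ E) → ℝ) := ContinuousLinearEquiv.ofFinrankEq (by simp)
  have h1 := isSmoothCovectorFamily_iff.1 (h.smooth_grad _ (fun t => c (e.symm t))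
    (isSmoothFieldFamily_iff.2 fun i => (hc i).comp e.symm.contDiff)) i
  simpa using h1.comp e.contDiff

theorem isEndConst (h : HasVarDeriv I G) (u : fieldSpace N) (i : Fin N) :
    IsEndConst (fun x => G u x i) :=
  (h.endFamily (E := ℝ) (c := fun _ => u)
    (fun i => smoothTestFamily_const (field_isTest u i)) i).isEndConst 0

/-- The fundamental lemma of the calculus of variations, with directions supported in one component;
continuity upgrades almost everywhere equality to equality. -/
theorem unique (h : HasVarDeriv I G) (h' : HasVarDeriv I H) : G = H := by
  funext u x i
  have hG := (h.isEndConst u i).1.continuous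
  have hH := (h'.isEndConst u i).1.continuous
  have hae : (fun x => G u x i) =ᵐ[volume] fun x => H u x i := by
    refine ae_eq_of_integral_contDiff_smul_eq hG.locallyIntegrable hH.locallyIntegrable
      fun g hg hg' => ?_
    let v : fieldSpace N := mkField (fun x => Pi.single i (g x)) fun j => by
      rcases eq_or_ne j i with rfl | hj
      · simp only [Pi.single_eq_same]
        exact ⟨hg, hg'⟩
      · simpa [Pi.single_apply, hj] using IsTest.zero
    have hv : ∀ F : fieldSpace N → ℝ → Fin N → ℝ,
        (∫ x, ∑ j, F u x j * (v : ℝ → Fin N → ℝ) x j) = ∫ x, g x • F u x i := by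
      intro F
      congr 1 with x
      simp [v, mkField, Pi.single_apply, mul_comm]
    rw [← hv, ← hv]
    exact (h.deriv_eq u v).unique (h'.deriv_eq u v)
  exact congrFun ((Continuous.ae_eq_iff_eq volume hG hH).1 hae) x

theorem varDeriv_eq (h : HasVarDeriv I G) : varDeriv I = G := by
  have hex : ∃ G, HasVarDeriv I G := ⟨G, h⟩
  rw [varDeriv, dif_pos hex]
  exact hex.choose_spec.unique h

theorem integrable_pairing (h : HasVarDeriv I G) (u v : fieldSpace N) :
    Integrable (fun x => ∑ i, G u x i * (v : ℝ → Fin N → ℝ) x i) :=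
  (IsTest.sum fun i _ => IsTest.mul_left (h.isEndConst u i).1 (field_isTest v i)).integrable

theorem add (h : HasVarDeriv I G) (h' : HasVarDeriv J H) :
    HasVarDeriv (I + J) (fun u x i => G u x i + H u x i) where
  deriv_eq u v := by
    refine ((h.deriv_eq u v).add (h'.deriv_eq u v)).congr_deriv ?_
    rw [← integral_add (h.integrable_pairing u v) (h'.integrable_pairing u v)]
    simp only [add_mul, Finset.sum_add_distrib]
  smooth k c hc := (h.smooth k c hc).add (h'.smooth k c hc)
  smooth_grad k c hc := isSmoothCovectorFamily_iff.2 fun i =>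
    (isSmoothCovectorFamily_iff.1 (h.smooth_grad k c hc) i).add
      (isSmoothCovectorFamily_iff.1 (h'.smooth_grad k c hc) i)

theorem smul (r : ℝ) (h : HasVarDeriv I G) :
    HasVarDeriv (r • I) (fun u x i => r * G u x i) where
  deriv_eq u v := by
    refine ((h.deriv_eq u v).const_mul r).congr_deriv ?_
    rw [← integral_const_mul]
    simp only [Finset.mul_sum, mul_assoc]
  smooth k c hc := contDiff_const.mul (h.smooth k c hc)
  smooth_grad k c hc := isSmoothCovectorFamily_iff.2 fun i =>
    (isSmoothCovectorFamily_iff.1 (h.smooth_grad k c hc) i).param_mul contDiff_const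

theorem mul (h : HasVarDeriv I G) (h' : HasVarDeriv J H) :
    HasVarDeriv (I * J) (fun u x i => I u * H u x i + J u * G u x i) where
  deriv_eq u v := by
    refine ((h.deriv_eq u v).mul (h'.deriv_eq u v)).congr_deriv ?_
    simp only [zero_smul, add_zero]
    rw [← integral_mul_const, ← integral_const_mul,
      ← integral_add ((h.integrable_pairing u v).mul_const _)
        ((h'.integrable_pairing u v).const_mul _)]
    congr 1 with x
    rw [Finset.sum_mul, Finset.mul_sum, ← Finset.sum_add_distrib]
    refine Finset.sum_congr rfl fun i _ => ?_
    ring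
  smooth k c hc := (h.smooth k c hc).mul (h'.smooth k c hc)
  smooth_grad k c hc := isSmoothCovectorFamily_iff.2 fun i =>
    ((isSmoothCovectorFamily_iff.1 (h'.smooth_grad k c hc) i).param_mul (h.smooth k c hc)).add
      ((isSmoothCovectorFamily_iff.1 (h.smooth_grad k c hc) i).param_mul (h'.smooth k c hc))

end HasVarDeriv

/-! ### The second variation -/

/-- The derivative of `u ↦ G u x i` at the field `u` in the direction `w`. -/
def secondVar (G : fieldSpace N → ℝ → Fin N → ℝ) (u w : fieldSpace N) (x : ℝ) (i : Fin N) : ℝ :=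
  deriv (fun ε : ℝ => G (u + ε • w) x i) 0

namespace HasVarDeriv

variable {I : Functional N} {G : fieldSpace N → ℝ → Fin N → ℝ}

theorem secondVar_endFamily [FiniteDimensional ℝ E] (h : HasVarDeriv I G) {c w : E → fieldSpace N}
    (hc : ∀ i, SmoothTestFamily (fun t x => (c t : ℝ → Fin N → ℝ) x i))
    (hw : ∀ i, SmoothTestFamily (fun t x => (w t : ℝ → Fin N → ℝ) x i)) (i : Fin N) :
    SmoothEndFamily (fun t x => secondVar G (c t) (w t) x i) :=
  (h.endFamily (smoothTestFamily_line hc hw) i).deriv_param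

theorem secondVar_isEndConst (h : HasVarDeriv I G) (u w : fieldSpace N) (i : Fin N) :
    IsEndConst (fun x => secondVar G u w x i) :=
  (h.secondVar_endFamily (E := ℝ) (c := fun _ => u) (w := fun _ => w)
    (fun i => smoothTestFamily_const (field_isTest u i))
    (fun i => smoothTestFamily_const (field_isTest w i)) i).isEndConst 0

theorem lineFamily (u v : fieldSpace N) (i : Fin N) :
    SmoothTestFamily
      (fun (ε : ℝ) x => ((u + ε • v : fieldSpace N) : ℝ → Fin N → ℝ) x i) :=
  (smoothTestFamily_const (field_isTest u i)).add
    (SmoothTestFamily.mul_left (f := fun (ε : ℝ) _ => ε) contDiff_fst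
      (smoothTestFamily_const (field_isTest v i)))

theorem endFamily_line (h : HasVarDeriv I G) (u v : fieldSpace N) (i : Fin N) :
    SmoothEndFamily (fun (ε : ℝ) x => G (u + ε • v) x i) :=
  h.endFamily (lineFamily u v) i

theorem hasDerivAt_grad (h : HasVarDeriv I G) (u v : fieldSpace N) (x : ℝ) (i : Fin N) :
    HasDerivAt (fun ε : ℝ => G (u + ε • v) x i) (secondVar G u v x i) 0 :=
  (((h.endFamily_line u v i).smooth.comp
    (contDiff_id.prodMk contDiff_const : ContDiff ℝ ∞ fun ε : ℝ => (ε, x))).differentiable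
    (by simp) 0 : DifferentiableAt ℝ (fun ε : ℝ => G (u + ε • v) x i) 0).hasDerivAt

theorem deriv_pairing (h : HasVarDeriv I G) (u v w : fieldSpace N) :
    deriv (fun s : ℝ => ∫ x, ∑ i, G (u + s • w) x i * (v : ℝ → Fin N → ℝ) x i) 0
      = ∫ x, ∑ i, secondVar G u w x i * (v : ℝ → Fin N → ℝ) x i := by
  have hf : SmoothTestFamily
      (fun (s : ℝ) x => ∑ i, G (u + s • w) x i * (v : ℝ → Fin N → ℝ) x i) :=
    SmoothTestFamily.sum fun i => SmoothTestFamily.mul_left (h.endFamily_line u w i).smooth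
      (smoothTestFamily_const (field_isTest v i))
  rw [hf.hasDerivAt_integral.deriv]
  congr 1 with x
  exact (HasDerivAt.fun_sum fun i _ => (h.hasDerivAt_grad u w x i).mul_const _).deriv

/-- Both sides are mixed second derivatives at the origin of `I (u + s • w + t • v)`. -/
theorem secondVar_symm (h : HasVarDeriv I G) (u v w : fieldSpace N) :
    ∫ x, ∑ i, secondVar G u w x i * (v : ℝ → Fin N → ℝ) x i
      = ∫ x, ∑ i, secondVar G u v x i * (w : ℝ → Fin N → ℝ) x i := by
  have hφ : ContDiff ℝ ∞ (fun p : ℝ × ℝ => I (u + p.1 • w + p.2 • v)) :=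
    h.contDiff_family (smoothTestFamily_line (c := fun s : ℝ => u + s • w) (w := fun _ => v)
      (lineFamily u w) fun i => smoothTestFamily_const (field_isTest v i))
  have hc := deriv_deriv_comm (φ := fun s t => I (u + s • w + t • v)) hφ 0 0
  have h1 : ∀ s : ℝ, deriv (fun t : ℝ => I (u + s • w + t • v)) 0
      = ∫ x, ∑ i, G (u + s • w) x i * (v : ℝ → Fin N → ℝ) x i :=
    fun s => (h.deriv_eq (u + s • w) v).deriv
  have h2 : ∀ t : ℝ, deriv (fun s : ℝ => I (u + s • w + t • v)) 0
      = ∫ x, ∑ i, G (u + t • v) x i * (w : ℝ → Fin N → ℝ) x i := fun t => by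
    simp only [add_right_comm u _ (t • v)]
    exact (h.deriv_eq (u + t • v) w).deriv
  simp only [h1, h2] at hc
  rwa [h.deriv_pairing, h.deriv_pairing] at hc

end HasVarDeriv

end Variational

/-! ### The operator `m d/dx - K (d/dx) ∘ u (d/dx)⁻¹ u ∘ (d/dx)` -/

section Operator

variable {N : ℕ}

/-- The function `uⁱ dξ_i/dx`. -/
def dotD (u ξ : ℝ → Fin N → ℝ) (x : ℝ) : ℝ :=
  ∑ i, u x i * deriv (fun y => ξ y i) x

/-- The function `m^{ij} dξ_j/dx - K d/dx (uⁱ (d/dx)⁻¹ (u^j dξ_j/dx))`. -/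
def hamOp (m : Matrix (Fin N) (Fin N) ℝ) (K : ℝ) (u ξ : ℝ → Fin N → ℝ) (x : ℝ) (i : Fin N) : ℝ :=
  (∑ j, m i j * deriv (fun y => ξ y j) x) - K * deriv (fun y => u y i * invD (dotD u ξ) y) x

/-- The density `ξ_i m^{ij} dζ_j/dx + K (uⁱ dξ_i/dx) (d/dx)⁻¹ (u^j dζ_j/dx)` of the bilinear form
of the operator. -/
def formDensity (m : Matrix (Fin N) (Fin N) ℝ) (K : ℝ) (u ξ ζ : ℝ → Fin N → ℝ) (x : ℝ) : ℝ :=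
  (∑ i, ∑ j, m i j * (ξ x i * deriv (fun y => ζ y j) x)) + K * (dotD u ξ x * invD (dotD u ζ) x)

variable {m : Matrix (Fin N) (Fin N) ℝ} {K : ℝ} {u ξ ζ lam : ℝ → Fin N → ℝ}

theorem dotD_isTest (hu : ∀ i, IsTest (fun x => u x i)) (hξ : ∀ i, IsEndConst (fun x => ξ x i)) :
    IsTest (dotD u ξ) :=
  IsTest.sum fun i _ => (hu i).mul_right (hξ i).deriv.1

theorem isTest_mul_invD_dotD (hu : ∀ i, IsTest (fun x => u x i))
    (hξ : ∀ i, IsEndConst (fun x => ξ x i)) (i : Fin N) :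
    IsTest (fun y => u y i * invD (dotD u ξ) y) :=
  (hu i).mul_right (contDiff_invD (dotD_isTest hu hξ))

theorem hamOp_isTest (hu : ∀ i, IsTest (fun x => u x i)) (hξ : ∀ i, IsEndConst (fun x => ξ x i))
    (i : Fin N) : IsTest (fun x => hamOp m K u ξ x i) :=
  (IsTest.sum fun j _ => (hξ j).deriv.const_mul _).sub
    ((isTest_mul_invD_dotD hu hξ i).deriv.const_mul _)

theorem hamOp_eq (hu : ∀ i, IsTest (fun x => u x i)) (hξ : ∀ i, IsEndConst (fun x => ξ x i))
    (x : ℝ) (i : Fin N) :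
    hamOp m K u ξ x i = (∑ j, m i j * deriv (fun y => ξ y j) x)
      - K * (deriv (fun y => u y i) x * invD (dotD u ξ) x + u x i * dotD u ξ x) := by
  rw [hamOp, (((hu i).hasDerivAt x).fun_mul (hasDerivAt_invD (dotD_isTest hu hξ) x)).deriv]

/-- Since `u^j ξ_j` is a test function, `D⁻¹(u^j_x ξ_j) = u^j ξ_j - D⁻¹(u^j ξ_j')`. The local term
cancels the contribution of `b`, and the remaining `K`-terms assemble by the product rule into `-K
D(uⁱ D⁻¹(u·ξ'))`. -/
theorem hydroOp_eq_hamOp (hu : ∀ i, IsTest (fun x => u x i))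
    (hξ : ∀ i, IsEndConst (fun x => ξ x i)) (x : ℝ) (i : Fin N) :
    hydroOp (quadMetric m K) (fun u i j k => -(K * (if i = k then 1 else 0) * u j)) K u ξ x i
      = hamOp m K u ξ x i := by
  have h1 : ∀ j, invD (fun y => deriv (fun z => u z j) y * ξ y j) x
      = u x j * ξ x j - invD (fun y => u y j * deriv (fun z => ξ z j) y) x := by
    intro j
    have ht : IsTest (fun y => u y j * ξ y j) := (hu j).mul_right (hξ j).1
    rw [← invD_deriv ht x, ← invD_sub ht.deriv.integrable
      ((hu j).mul_right (hξ j).deriv.1).integrable]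
    congr 1
    funext y
    rw [(((hu j).hasDerivAt y).fun_mul ((hξ j).hasDerivAt y)).deriv]
    ring
  have h2 : invD (dotD u ξ) x = ∑ j, invD (fun y => u y j * deriv (fun z => ξ z j) y) x :=
    invD_sum _ (fun j _ => ((hu j).mul_right (hξ j).deriv.1).integrable) x
  rw [hamOp_eq hu hξ, h2, dotD, mul_add, Finset.mul_sum, Finset.mul_sum, Finset.mul_sum,
    Finset.mul_sum, ← Finset.sum_add_distrib, ← Finset.sum_sub_distrib, hydroOp]
  refine Finset.sum_congr rfl fun j _ => ?_
  have h3 : ∑ k, -(K * (if i = k then 1 else 0) * u x j) * deriv (fun y => u y k) x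
      = -(K * u x j * deriv (fun y => u y i) x) := by
    rw [Finset.sum_eq_single i (fun k _ hk => by simp [hk.symm]) (by simp)]
    simp
  rw [h1, h3, quadMetric, Matrix.of_apply]
  ring

theorem formDensity_isTest (hu : ∀ i, IsTest (fun x => u x i))
    (hξ : ∀ i, IsEndConst (fun x => ξ x i)) (hζ : ∀ i, IsEndConst (fun x => ζ x i)) :
    IsTest (formDensity m K u ξ ζ) :=
  (IsTest.sum fun i _ => IsTest.sum fun j _ => (IsTest.mul_left (hξ i).1 (hζ j).deriv).const_mul _).add
    (((dotD_isTest hu hξ).mul_right (contDiff_invD (dotD_isTest hu hζ))).const_mul _)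

theorem pairing_isTest (hu : ∀ i, IsTest (fun x => u x i))
    (hξ : ∀ i, IsEndConst (fun x => ξ x i)) (hζ : ∀ i, IsEndConst (fun x => ζ x i)) :
    IsTest (fun x => ∑ i, ξ x i * hamOp m K u ζ x i) :=
  IsTest.sum fun i _ => IsTest.mul_left (hξ i).1 (hamOp_isTest hu hζ i)

/-- The two integrands differ by the derivative of `-K ξ_i uⁱ D⁻¹(u·ζ')`, a test function. -/
theorem integral_pairing_eq_form (hu : ∀ i, IsTest (fun x => u x i))
    (hξ : ∀ i, IsEndConst (fun x => ξ x i)) (hζ : ∀ i, IsEndConst (fun x => ζ x i)) :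
    ∫ x, ∑ i, ξ x i * hamOp m K u ζ x i = ∫ x, formDensity m K u ξ ζ x := by
  have hT : IsTest (fun x => K * ∑ i, ξ x i * (u x i * invD (dotD u ζ) x)) :=
    (IsTest.sum fun i _ => IsTest.mul_left (hξ i).1 (isTest_mul_invD_dotD hu hζ i)).const_mul K
  rw [← sub_eq_zero, ← integral_sub (pairing_isTest hu hξ hζ).integrable
    (formDensity_isTest hu hξ hζ).integrable, ← neg_eq_zero, ← integral_neg, ← hT.integral_deriv]
  congr 1 with x
  rw [((HasDerivAt.fun_sum (u := Finset.univ) fun i _ => ((hξ i).hasDerivAt x).fun_mul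
    ((isTest_mul_invD_dotD hu hζ i).hasDerivAt x)).const_mul K).deriv]
  simp only [formDensity, hamOp, dotD, Finset.sum_mul, Finset.mul_sum, ← Finset.sum_sub_distrib,
    ← Finset.sum_add_distrib, ← Finset.sum_neg_distrib]
  refine Finset.sum_congr rfl fun i _ => ?_
  simp only [mul_sub, Finset.mul_sum]
  rw [Finset.sum_congr rfl fun j _ => mul_left_comm (ξ x i) (m i j) _]
  ring

/-- By symmetry of `m`, the local parts add up to the derivative of `m^{ij} ξ_i ζ_j`, which is
constant near the ends. The nonlocal part is skew because `D⁻¹` is. -/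
theorem integral_form_skew (hm : m.IsSymm) (hu : ∀ i, IsTest (fun x => u x i))
    (hξ : ∀ i, IsEndConst (fun x => ξ x i)) (hζ : ∀ i, IsEndConst (fun x => ζ x i)) :
    ∫ x, formDensity m K u ξ ζ x = - ∫ x, formDensity m K u ζ ξ x := by
  have hA : ∀ {ξ ζ : ℝ → Fin N → ℝ}, (∀ i, IsEndConst (fun x => ξ x i)) →
      (∀ i, IsEndConst (fun x => ζ x i)) →
      IsTest (fun x => ∑ i, ∑ j, m i j * (ξ x i * deriv (fun y => ζ y j) x)) := fun hξ hζ =>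
    IsTest.sum fun i _ => IsTest.sum fun j _ => (IsTest.mul_left (hξ i).1 (hζ j).deriv).const_mul _
  have hB : ∀ {ξ ζ : ℝ → Fin N → ℝ}, (∀ i, IsEndConst (fun x => ξ x i)) →
      (∀ i, IsEndConst (fun x => ζ x i)) →
      IsTest (fun x => K * (dotD u ξ x * invD (dotD u ζ) x)) := fun hξ hζ =>
    ((dotD_isTest hu hξ).mul_right (contDiff_invD (dotD_isTest hu hζ))).const_mul _
  have h1 : (∫ x, ∑ i, ∑ j, m i j * (ξ x i * deriv (fun y => ζ y j) x))
      + ∫ x, ∑ i, ∑ j, m i j * (ζ x i * deriv (fun y => ξ y j) x) = 0 := by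
    rw [← integral_add (hA hξ hζ).integrable (hA hζ hξ).integrable]
    have hE : ∀ i j, IsEndConst (fun x => ξ x i * ζ x j) := fun i j => (hξ i).mul (hζ j)
    have h0 : ∫ x, ∑ i, ∑ j, m i j * deriv (fun y => ξ y i * ζ y j) x = 0 := by
      have hI : ∀ i, IsTest (fun x => ∑ j, m i j * deriv (fun y => ξ y i * ζ y j) x) :=
        fun i => IsTest.sum fun j _ => (hE i j).deriv.const_mul _
      rw [integral_finsetSum _ fun i _ => (hI i).integrable]
      refine Finset.sum_eq_zero fun i _ => ?_
      rw [integral_finsetSum _ fun j _ => ((hE i j).deriv.const_mul _).integrable]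
      refine Finset.sum_eq_zero fun j _ => ?_
      rw [integral_const_mul, (hE i j).integral_deriv, mul_zero]
    rw [← h0]
    congr 1 with x
    rw [Finset.sum_comm (f := fun i j => m i j * (ζ x i * deriv (fun y => ξ y j) x)),
      ← Finset.sum_add_distrib]
    refine Finset.sum_congr rfl fun i _ => ?_
    rw [← Finset.sum_add_distrib]
    refine Finset.sum_congr rfl fun j _ => ?_
    rw [(((hξ i).hasDerivAt x).fun_mul ((hζ j).hasDerivAt x)).deriv, hm.apply i j]
    ring
  have h2 := integral_mul_invD_skew (dotD_isTest hu hξ) (dotD_isTest hu hζ)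
  simp only [formDensity]
  rw [integral_add (hA hξ hζ).integrable (hB hξ hζ).integrable,
    integral_add (hA hζ hξ).integrable (hB hζ hξ).integrable,
    integral_const_mul, integral_const_mul, h2]
  linear_combination h1

theorem integral_pairing_skew (hm : m.IsSymm) (hu : ∀ i, IsTest (fun x => u x i))
    (hξ : ∀ i, IsEndConst (fun x => ξ x i)) (hζ : ∀ i, IsEndConst (fun x => ζ x i)) :
    ∫ x, ∑ i, ξ x i * hamOp m K u ζ x i = - ∫ x, ∑ i, ζ x i * hamOp m K u ξ x i := by
  rw [integral_pairing_eq_form hu hξ hζ, integral_pairing_eq_form hu hζ hξ,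
    integral_form_skew hm hu hξ hζ]

/-- The part of the variational derivative of a bracket that does not involve second variations. -/
def explicitVar (u ξ ζ : ℝ → Fin N → ℝ) (x : ℝ) (i : Fin N) : ℝ :=
  deriv (fun y => ξ y i) x * invD (dotD u ζ) x - deriv (fun y => ζ y i) x * invD (dotD u ξ) x

theorem explicitVar_isTest (hu : ∀ i, IsTest (fun x => u x i))
    (hξ : ∀ i, IsEndConst (fun x => ξ x i)) (hζ : ∀ i, IsEndConst (fun x => ζ x i)) (i : Fin N) :
    IsTest (fun x => explicitVar u ξ ζ x i) :=
  ((hξ i).deriv.mul_right (contDiff_invD (dotD_isTest hu hζ))).sub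
    ((hζ i).deriv.mul_right (contDiff_invD (dotD_isTest hu hξ)))

theorem explicitVar_pairing_isTest (hu : ∀ i, IsTest (fun x => u x i))
    (hξ : ∀ i, IsEndConst (fun x => ξ x i)) (hζ : ∀ i, IsEndConst (fun x => ζ x i))
    (hl : ∀ i, IsEndConst (fun x => lam x i)) :
    IsTest (fun x => ∑ i, explicitVar u ξ ζ x i * hamOp m K u lam x i) :=
  IsTest.sum fun i _ => (explicitVar_isTest hu hξ hζ i).mul_right (hamOp_isTest hu hl i).1

/-- Collects the integrand into scalar factors at `x`, so that its cyclic sum becomes a polynomial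
identity. -/
theorem explicitVar_pairing_eq (hu : ∀ i, IsTest (fun x => u x i))
    (hl : ∀ i, IsEndConst (fun x => lam x i)) (x : ℝ) :
    ∑ i, explicitVar u ξ ζ x i * hamOp m K u lam x i
      = invD (dotD u ζ) x
          * (∑ i, ∑ j, m i j * (deriv (fun y => ξ y i) x * deriv (fun y => lam y j) x))
        - invD (dotD u ξ) x
          * (∑ i, ∑ j, m i j * (deriv (fun y => ζ y i) x * deriv (fun y => lam y j) x))
        - K * ((invD (dotD u ζ) x * (∑ i, deriv (fun y => ξ y i) x * deriv (fun y => u y i) x)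
            - invD (dotD u ξ) x * (∑ i, deriv (fun y => ζ y i) x * deriv (fun y => u y i) x))
              * invD (dotD u lam) x
          + (invD (dotD u ζ) x * dotD u ξ x - invD (dotD u ξ) x * dotD u ζ x) * dotD u lam x) := by
  have h1 : ∀ i, explicitVar u ξ ζ x i * hamOp m K u lam x i
      = invD (dotD u ζ) x
          * (∑ j, m i j * (deriv (fun y => ξ y i) x * deriv (fun y => lam y j) x))
        - invD (dotD u ξ) x
          * (∑ j, m i j * (deriv (fun y => ζ y i) x * deriv (fun y => lam y j) x))
        - K * ((invD (dotD u ζ) x * (deriv (fun y => ξ y i) x * deriv (fun y => u y i) x)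
            - invD (dotD u ξ) x * (deriv (fun y => ζ y i) x * deriv (fun y => u y i) x))
              * invD (dotD u lam) x
          + (invD (dotD u ζ) x * (u x i * deriv (fun y => ξ y i) x)
            - invD (dotD u ξ) x * (u x i * deriv (fun y => ζ y i) x)) * dotD u lam x) := by
    intro i
    have e : ∀ a : ℝ, ∑ j, m i j * (a * deriv (fun y => lam y j) x)
        = a * ∑ j, m i j * deriv (fun y => lam y j) x := fun a => by
      rw [Finset.mul_sum]
      exact Finset.sum_congr rfl fun j _ => mul_left_comm _ _ _
    rw [hamOp_eq hu hl, e, e, explicitVar]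
    ring
  rw [Finset.sum_congr rfl fun i _ => h1 i]
  simp only [Finset.sum_sub_distrib, Finset.sum_add_distrib, ← Finset.mul_sum, ← Finset.sum_mul]
  rfl

/-- The cyclic sum of the integrands is zero at every point, with no further integration by parts.
-/
theorem explicitVar_pairing_cyclic (hm : m.IsSymm) (hu : ∀ i, IsTest (fun x => u x i))
    (hξ : ∀ i, IsEndConst (fun x => ξ x i)) (hζ : ∀ i, IsEndConst (fun x => ζ x i))
    (hl : ∀ i, IsEndConst (fun x => lam x i)) :
    (∫ x, ∑ i, explicitVar u ξ ζ x i * hamOp m K u lam x i)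
      + (∫ x, ∑ i, explicitVar u ζ lam x i * hamOp m K u ξ x i)
      + ∫ x, ∑ i, explicitVar u lam ξ x i * hamOp m K u ζ x i = 0 := by
  have i1 := explicitVar_pairing_isTest (m := m) (K := K) hu hξ hζ hl
  have i2 := explicitVar_pairing_isTest (m := m) (K := K) hu hζ hl hξ
  have i3 := explicitVar_pairing_isTest (m := m) (K := K) hu hl hξ hζ
  rw [← integral_add i1.integrable i2.integrable,
    ← integral_add (i1.add i2).integrable i3.integrable]
  refine integral_eq_zero_of_ae (Eventually.of_forall fun x => ?_)
  -- Symmetry of `m` brings the quadratic sums to a common order, after which `ring` sees them as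
  -- equal atoms.
  have hM : ∀ a b : Fin N → ℝ,
      ∑ i, ∑ j, m i j * (a i * b j) = ∑ i, ∑ j, m i j * (b i * a j) := by
    intro a b
    rw [Finset.sum_comm]
    refine Finset.sum_congr rfl fun i _ => Finset.sum_congr rfl fun j _ => ?_
    rw [hm.apply i j, mul_comm (a j)]
  simp only [Pi.zero_apply]
  rw [explicitVar_pairing_eq hu hl, explicitVar_pairing_eq hu hξ, explicitVar_pairing_eq hu hζ,
    hM (fun i => deriv (fun y => lam y i) x) (fun i => deriv (fun y => ξ y i) x),
    hM (fun i => deriv (fun y => ζ y i) x) (fun i => deriv (fun y => ξ y i) x),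
    hM (fun i => deriv (fun y => lam y i) x) (fun i => deriv (fun y => ζ y i) x)]
  ring

end Operator

/-! ### Families -/

section Families

variable {E : Type*} [NormedAddCommGroup E] [NormedSpace ℝ E] {N : ℕ}
  {m : Matrix (Fin N) (Fin N) ℝ} {K : ℝ} {u ξ ζ : E → ℝ → Fin N → ℝ}

theorem dotD_family (hu : ∀ i, SmoothTestFamily (fun t x => u t x i))
    (hξ : ∀ i, SmoothEndFamily (fun t x => ξ t x i)) :
    SmoothTestFamily (fun t => dotD (u t) (ξ t)) :=
  SmoothTestFamily.sum fun i => (hu i).mul_right (hξ i).deriv_snd.smooth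

variable [ProperSpace E]

theorem hamOp_family (hu : ∀ i, SmoothTestFamily (fun t x => u t x i))
    (hξ : ∀ i, SmoothEndFamily (fun t x => ξ t x i)) (i : Fin N) :
    SmoothTestFamily (fun t x => hamOp m K (u t) (ξ t) x i) :=
  (SmoothTestFamily.sum fun j => (hξ j).deriv_snd.const_mul _).sub
    ((SmoothEndFamily.of_test ((hu i).mul_right
      (dotD_family hu hξ).smooth_invD)).deriv_snd.const_mul _)

theorem formDensity_family (hu : ∀ i, SmoothTestFamily (fun t x => u t x i))
    (hξ : ∀ i, SmoothEndFamily (fun t x => ξ t x i))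
    (hζ : ∀ i, SmoothEndFamily (fun t x => ζ t x i)) :
    SmoothTestFamily (fun t => formDensity m K (u t) (ξ t) (ζ t)) :=
  (SmoothTestFamily.sum fun i => SmoothTestFamily.sum fun j =>
    (SmoothTestFamily.mul_left (hξ i).smooth (hζ j).deriv_snd).const_mul _).add
    (((dotD_family hu hξ).mul_right (dotD_family hu hζ).smooth_invD).const_mul _)

theorem explicitVar_family (hu : ∀ i, SmoothTestFamily (fun t x => u t x i))
    (hξ : ∀ i, SmoothEndFamily (fun t x => ξ t x i))
    (hζ : ∀ i, SmoothEndFamily (fun t x => ζ t x i)) (i : Fin N) :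
    SmoothTestFamily (fun t x => explicitVar (u t) (ξ t) (ζ t) x i) :=
  ((hξ i).deriv_snd.mul_right (dotD_family hu hζ).smooth_invD).sub
    ((hζ i).deriv_snd.mul_right (dotD_family hu hξ).smooth_invD)

end Families

/-! ### The Poisson bracket -/

section Bracket

variable {N : ℕ} {m : Matrix (Fin N) (Fin N) ℝ} {K : ℝ}

/-- The Hamiltonian vector field with variational derivative `G`. -/
def hamField (m : Matrix (Fin N) (Fin N) ℝ) (K : ℝ) {J : Functional N}
    {G : fieldSpace N → ℝ → Fin N → ℝ} (h : HasVarDeriv J G) (u : fieldSpace N) : fieldSpace N :=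
  mkField (hamOp m K u (G u)) (hamOp_isTest (field_isTest u) (h.isEndConst u))

variable {I J L : Functional N} {G H Λ : fieldSpace N → ℝ → Fin N → ℝ}

/-- The bracket of two functionals, as a bilinear expression in the variational derivatives. -/
def pairing (m : Matrix (Fin N) (Fin N) ℝ) (K : ℝ) (G H : fieldSpace N → ℝ → Fin N → ℝ)
    (u : fieldSpace N) : ℝ :=
  ∫ x, ∑ i, G u x i * hamOp m K u (H u) x i

theorem hydroBracket_eq_pairing (hI : HasVarDeriv I G) (hJ : HasVarDeriv J H) :
    hydroBracket (quadMetric m K) (fun u i j k => -(K * (if i = k then 1 else 0) * u j)) K I J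
      = pairing m K G H := by
  funext u
  rw [hydroBracket, hI.varDeriv_eq, hJ.varDeriv_eq, pairing]
  congr 1 with x
  exact Finset.sum_congr rfl fun i _ => by
    rw [hydroOp_eq_hamOp (field_isTest u) (hJ.isEndConst u)]

/-- The variational derivative of a bracket. -/
def bracketVar (m : Matrix (Fin N) (Fin N) ℝ) (K : ℝ) (hI : HasVarDeriv I G)
    (hJ : HasVarDeriv J H) (u : fieldSpace N) (x : ℝ) (i : Fin N) : ℝ :=
  secondVar G u (hamField m K hJ u) x i - secondVar H u (hamField m K hI u) x i
    + K * explicitVar u (G u) (H u) x i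

/-! ### The first variation of the bracket. -/

theorem hasDerivAt_field_line (u v : fieldSpace N) (x : ℝ) (i : Fin N) :
    HasDerivAt (fun ε : ℝ => ((u + ε • v : fieldSpace N) : ℝ → Fin N → ℝ) x i)
      ((v : ℝ → Fin N → ℝ) x i) 0 := by
  simpa using ((hasDerivAt_id (0 : ℝ)).mul_const ((v : ℝ → Fin N → ℝ) x i)).const_add
    ((u : ℝ → Fin N → ℝ) x i)

theorem HasVarDeriv.hasDerivAt_deriv_grad (h : HasVarDeriv I G) (u v : fieldSpace N) (x : ℝ)
    (i : Fin N) :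
    HasDerivAt (fun ε : ℝ => deriv (fun y => G (u + ε • v) y i) x)
      (deriv (fun y => secondVar G u v y i) x) 0 := by
  have hs := (h.endFamily_line u v i).smooth
  have hd : DifferentiableAt ℝ (fun ε : ℝ => deriv (fun y => G (u + ε • v) y i) x) 0 :=
    ((contDiff_deriv_snd (f := fun ε y => G (u + ε • v) y i) hs).comp (contDiff_id.prodMk contDiff_const :
      ContDiff ℝ ∞ fun ε : ℝ => (ε, x))).differentiable (by simp) 0
  have he := hd.hasDerivAt
  rwa [deriv_deriv_comm (φ := fun ε y => G (u + ε • v) y i) hs] at he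

theorem HasVarDeriv.hasDerivAt_dotD (h : HasVarDeriv I G) (u v : fieldSpace N) (x : ℝ) :
    HasDerivAt (fun ε : ℝ => dotD (u + ε • v : fieldSpace N) (G (u + ε • v)) x)
      (dotD v (G u) x + dotD u (secondVar G u v) x) 0 := by
  have := HasDerivAt.fun_sum (u := Finset.univ) fun i _ =>
    (hasDerivAt_field_line u v x i).fun_mul (h.hasDerivAt_deriv_grad u v x i)
  simpa only [dotD, zero_smul, add_zero, Finset.sum_add_distrib] using this

theorem HasVarDeriv.hasDerivAt_invD_dotD (h : HasVarDeriv I G) (u v : fieldSpace N) (x : ℝ) :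
    HasDerivAt (fun ε : ℝ => invD (dotD (u + ε • v : fieldSpace N) (G (u + ε • v))) x)
      (invD (dotD v (G u)) x + invD (dotD u (secondVar G u v)) x) 0 := by
  have := (dotD_family (HasVarDeriv.lineFamily u v) (h.endFamily_line u v)).hasDerivAt_invD_param x
  rw [← invD_add (dotD_isTest (field_isTest v) (h.isEndConst u)).integrable
    (dotD_isTest (field_isTest u) (h.secondVar_isEndConst u v)).integrable]
  simpa only [(h.hasDerivAt_dotD u v _).deriv] using this

theorem hasDerivAt_formDensity (hI : HasVarDeriv I G) (hJ : HasVarDeriv J H)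
    (u v : fieldSpace N) (x : ℝ) :
    HasDerivAt (fun ε : ℝ =>
        formDensity m K (u + ε • v : fieldSpace N) (G (u + ε • v)) (H (u + ε • v)) x)
      (formDensity m K u (secondVar G u v) (H u) x + formDensity m K u (G u) (secondVar H u v) x
        + K * (dotD v (G u) x * invD (dotD u (H u)) x + dotD u (G u) x * invD (dotD v (H u)) x))
      0 := by
  have h1 := HasDerivAt.fun_sum (u := Finset.univ) fun i _ =>
    HasDerivAt.fun_sum (u := Finset.univ) fun j _ =>
      ((hI.hasDerivAt_grad u v x i).fun_mul (hJ.hasDerivAt_deriv_grad u v x j)).const_mul (m i j)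
  have h2 := ((hI.hasDerivAt_dotD u v x).fun_mul (hJ.hasDerivAt_invD_dotD u v x)).const_mul K
  refine (h1.fun_add h2).congr_deriv ?_
  simp only [zero_smul, add_zero, formDensity, mul_add, Finset.sum_add_distrib]
  ring

/-- The density is differentiated by the product rule, and everything is then moved onto `v`.
Skewness puts the operator on the covector that is not varied, self-adjointness of the second
variation frees `v`, and skewness of `D⁻¹` does the same for the term with `D⁻¹(v·H')`. -/
theorem hasDerivAt_pairing (hm : m.IsSymm) (hI : HasVarDeriv I G) (hJ : HasVarDeriv J H)
    (u v : fieldSpace N) :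
    HasDerivAt (fun ε : ℝ => pairing m K G H (u + ε • v))
      (∫ x, ∑ i, bracketVar m K hI hJ u x i * (v : ℝ → Fin N → ℝ) x i) 0 := by
  have hu := field_isTest u
  have hv := field_isTest v
  have hG := hI.isEndConst u
  have hH := hJ.isEndConst u
  have hG' := hI.secondVar_isEndConst u v
  have hH' := hJ.secondVar_isEndConst u v
  have hform := (formDensity_family (m := m) (K := K) (HasVarDeriv.lineFamily u v)
    (hI.endFamily_line u v) (hJ.endFamily_line u v)).hasDerivAt_integral
  have hfun : (fun ε : ℝ => pairing m K G H (u + ε • v)) = fun ε : ℝ =>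
      ∫ x, formDensity m K (u + ε • v : fieldSpace N) (G (u + ε • v)) (H (u + ε • v)) x :=
    funext fun ε => integral_pairing_eq_form (field_isTest _) (hI.isEndConst _) (hJ.isEndConst _)
  rw [hfun]
  refine hform.congr_deriv ?_
  simp only [(hasDerivAt_formDensity hI hJ u v _).deriv]
  have t1 := formDensity_isTest (m := m) (K := K) hu hG' hH
  have t2 := formDensity_isTest (m := m) (K := K) hu hG hH'
  have t3 := (dotD_isTest hv hG).mul_right (contDiff_invD (dotD_isTest hu hH))
  have t4 := (dotD_isTest hu hG).mul_right (contDiff_invD (dotD_isTest hv hH))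
  have t5 := (dotD_isTest hv hH).mul_right (contDiff_invD (dotD_isTest hu hG))
  rw [integral_add (t1.add t2).integrable ((t3.add t4).const_mul K).integrable,
    integral_add t1.integrable t2.integrable, integral_const_mul,
    integral_add t3.integrable t4.integrable,
    integral_mul_invD_skew (dotD_isTest hu hG) (dotD_isTest hv hH),
    integral_form_skew hm hu hG hH', ← integral_pairing_eq_form hu hG' hH,
    ← integral_pairing_eq_form hu hH' hG]
  -- `hamOp` is by definition the underlying function of `hamField`, so `secondVar_symm` applies
  -- with the Hamiltonian field as a direction.
  have s1 : ∫ x, ∑ i, secondVar G u v x i * hamOp m K u (H u) x i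
      = ∫ x, ∑ i, secondVar G u (hamField m K hJ u) x i * (v : ℝ → Fin N → ℝ) x i :=
    hI.secondVar_symm u (hamField m K hJ u) v
  have s2 : ∫ x, ∑ i, secondVar H u v x i * hamOp m K u (G u) x i
      = ∫ x, ∑ i, secondVar H u (hamField m K hI u) x i * (v : ℝ → Fin N → ℝ) x i :=
    hJ.secondVar_symm u (hamField m K hI u) v
  have r1 : IsTest (fun x => ∑ i, secondVar G u (hamField m K hJ u) x i
      * (v : ℝ → Fin N → ℝ) x i) :=
    IsTest.sum fun i _ => IsTest.mul_left (hI.secondVar_isEndConst u _ i).1 (hv i)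
  have r2 : IsTest (fun x => ∑ i, secondVar H u (hamField m K hI u) x i
      * (v : ℝ → Fin N → ℝ) x i) :=
    IsTest.sum fun i _ => IsTest.mul_left (hJ.secondVar_isEndConst u _ i).1 (hv i)
  rw [s1, s2, ← sub_eq_add_neg, ← sub_eq_add_neg, ← integral_sub r1.integrable r2.integrable,
    ← integral_sub t3.integrable t5.integrable, ← integral_const_mul,
    ← integral_add (r1.sub r2).integrable ((t3.sub t5).const_mul K).integrable]
  congr 1 with x
  simp only [dotD, bracketVar, explicitVar, Finset.sum_mul, Finset.mul_sum,
    ← Finset.sum_sub_distrib, ← Finset.sum_add_distrib]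
  exact Finset.sum_congr rfl fun i _ => by ring

/-- The second-variation terms may have nonzero end constants, while the explicit term is a test
family; together they stay in the class of admissible covectors. -/
theorem HasVarDeriv.bracket (hm : m.IsSymm) (hI : HasVarDeriv I G) (hJ : HasVarDeriv J H) :
    HasVarDeriv (pairing m K G H) (bracketVar m K hI hJ) where
  deriv_eq := hasDerivAt_pairing hm hI hJ
  smooth k c hc := by
    rw [isSmoothFieldFamily_iff] at hc
    have : (fun t => pairing m K G H (c t))
        = fun t => ∫ x, formDensity m K (c t) (G (c t)) (H (c t)) x :=
      funext fun t => integral_pairing_eq_form (field_isTest _) (hI.isEndConst _) (hJ.isEndConst _)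
    rw [this]
    exact (formDensity_family hc (hI.endFamily hc) (hJ.endFamily hc)).smooth_integral
  smooth_grad k c hc := by
    rw [isSmoothFieldFamily_iff] at hc
    refine isSmoothCovectorFamily_iff.2 fun i => ?_
    have h1 := hI.secondVar_endFamily hc (w := fun t => hamField m K hJ (c t))
      (fun j => hamOp_family hc (hJ.endFamily hc) j) i
    have h2 := hJ.secondVar_endFamily hc (w := fun t => hamField m K hI (c t))
      (fun j => hamOp_family hc (hI.endFamily hc) j) i
    have h3 := (explicitVar_family hc (hI.endFamily hc) (hJ.endFamily hc) i).const_mul K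
    exact (h1.sub h2).add (.of_test h3)

/-! ### Skew symmetry, the Jacobi identity and the Poisson property. -/

theorem pairing_skew (hm : m.IsSymm) (hI : HasVarDeriv I G) (hJ : HasVarDeriv J H) :
    pairing m K G H = - pairing m K H G :=
  funext fun u => integral_pairing_skew hm (field_isTest u) (hI.isEndConst u) (hJ.isEndConst u)

theorem pairing_bracketVar (hI : HasVarDeriv I G) (hJ : HasVarDeriv J H) (hL : HasVarDeriv L Λ)
    (u : fieldSpace N) :
    pairing m K (bracketVar m K hI hJ) Λ u
      = (∫ x, ∑ i, secondVar G u (hamField m K hJ u) x i * hamOp m K u (Λ u) x i)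
        - (∫ x, ∑ i, secondVar H u (hamField m K hI u) x i * hamOp m K u (Λ u) x i)
        + K * ∫ x, ∑ i, explicitVar u (G u) (H u) x i * hamOp m K u (Λ u) x i := by
  have hu := field_isTest u
  have hΛ := hL.isEndConst u
  have t1 := pairing_isTest (m := m) (K := K) hu
    (hI.secondVar_isEndConst u (hamField m K hJ u)) hΛ
  have t2 := pairing_isTest (m := m) (K := K) hu
    (hJ.secondVar_isEndConst u (hamField m K hI u)) hΛ
  have t3 := (explicitVar_pairing_isTest (m := m) (K := K) hu (hI.isEndConst u)
    (hJ.isEndConst u) hΛ).const_mul K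
  rw [← integral_sub t1.integrable t2.integrable, ← integral_const_mul,
    ← integral_add (t1.sub t2).integrable t3.integrable, pairing]
  congr 1 with x
  simp only [bracketVar, Finset.mul_sum, ← Finset.sum_sub_distrib, ← Finset.sum_add_distrib]
  exact Finset.sum_congr rfl fun i _ => by ring

/-- The six second-variation terms cancel in pairs by self-adjointness, one pair for each
functional; the explicit terms cancel cyclically. -/
theorem pairing_jacobi (hm : m.IsSymm) (hI : HasVarDeriv I G) (hJ : HasVarDeriv J H)
    (hL : HasVarDeriv L Λ) :
    pairing m K (bracketVar m K hI hJ) Λ + pairing m K (bracketVar m K hJ hL) G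
      + pairing m K (bracketVar m K hL hI) H = 0 := by
  funext u
  have s1 := hI.secondVar_symm u (hamField m K hL u) (hamField m K hJ u)
  have s2 := hJ.secondVar_symm u (hamField m K hL u) (hamField m K hI u)
  have s3 := hL.secondVar_symm u (hamField m K hJ u) (hamField m K hI u)
  have s := explicitVar_pairing_cyclic (K := K) hm (field_isTest u) (hI.isEndConst u)
    (hJ.isEndConst u) (hL.isEndConst u)
  simp only [Pi.add_apply, Pi.zero_apply, pairing_bracketVar hI hJ hL, pairing_bracketVar hJ hL hI,
    pairing_bracketVar hL hI hJ]
  -- These `change`s unfold `hamField` to `hamOp`, so that the terms match those of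
  -- `pairing_bracketVar`.
  change _ = ∫ x, ∑ i, _ * hamOp m K u (H u) x i at s1
  change _ = ∫ x, ∑ i, _ * hamOp m K u (G u) x i at s2
  change _ = ∫ x, ∑ i, _ * hamOp m K u (G u) x i at s3
  change (∫ x, ∑ i, _ * hamOp m K u (Λ u) x i) = _ at s1
  change (∫ x, ∑ i, _ * hamOp m K u (Λ u) x i) = _ at s2
  change (∫ x, ∑ i, _ * hamOp m K u (H u) x i) = _ at s3
  linear_combination s1 - s2 + s3 + K * s

theorem pairing_integrable (hI : HasVarDeriv I G) (hJ : HasVarDeriv J H) (u : fieldSpace N) :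
    Integrable (fun x => ∑ i, G u x i * hamOp m K u (H u) x i) :=
  (pairing_isTest (field_isTest u) (hI.isEndConst u) (hJ.isEndConst u)).integrable

theorem isPoisson_quadMetric (hm : m.IsSymm) :
    IsPoisson (quadMetric m K) (fun u i j k => -(K * (if i = k then 1 else 0) * u j)) K where
  add_mem := by
    rintro I ⟨G, hI⟩ J ⟨H, hJ⟩
    exact ⟨_, hI.add hJ⟩
  smul_mem := by
    rintro r I ⟨G, hI⟩
    exact ⟨_, hI.smul r⟩
  mul_mem := by
    rintro I ⟨G, hI⟩ J ⟨H, hJ⟩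
    exact ⟨_, hI.mul hJ⟩
  bracket_mem := by
    rintro I ⟨G, hI⟩ J ⟨H, hJ⟩
    rw [hydroBracket_eq_pairing hI hJ]
    exact ⟨_, hI.bracket hm hJ⟩
  add_left := by
    rintro I ⟨G, hI⟩ J ⟨H, hJ⟩ L ⟨Λ, hL⟩
    rw [hydroBracket_eq_pairing (hI.add hJ) hL, hydroBracket_eq_pairing hI hL,
      hydroBracket_eq_pairing hJ hL]
    funext u
    simp only [Pi.add_apply, pairing]
    rw [← integral_add (pairing_integrable hI hL u) (pairing_integrable hJ hL u)]
    simp only [add_mul, Finset.sum_add_distrib]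
  smul_left := by
    rintro r I ⟨G, hI⟩ J ⟨H, hJ⟩
    rw [hydroBracket_eq_pairing (hI.smul r) hJ, hydroBracket_eq_pairing hI hJ]
    funext u
    simp only [Pi.smul_apply, pairing, smul_eq_mul]
    rw [← integral_const_mul]
    simp only [Finset.mul_sum, mul_assoc]
  skew := by
    rintro I ⟨G, hI⟩ J ⟨H, hJ⟩
    rw [hydroBracket_eq_pairing hI hJ, hydroBracket_eq_pairing hJ hI, pairing_skew hm hI hJ]
  leibniz := by
    rintro I ⟨G, hI⟩ J ⟨H, hJ⟩ L ⟨Λ, hL⟩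
    rw [hydroBracket_eq_pairing (hI.mul hJ) hL, hydroBracket_eq_pairing hI hL,
      hydroBracket_eq_pairing hJ hL]
    funext u
    simp only [Pi.add_apply, Pi.mul_apply, pairing]
    rw [← integral_mul_const, ← integral_const_mul,
      ← integral_add ((pairing_integrable hJ hL u).const_mul _)
        ((pairing_integrable hI hL u).mul_const _)]
    congr 1 with x
    rw [Finset.sum_mul, Finset.mul_sum, ← Finset.sum_add_distrib]
    exact Finset.sum_congr rfl fun i _ => by ring
  jacobi := by
    rintro I ⟨G, hI⟩ J ⟨H, hJ⟩ L ⟨Λ, hL⟩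
    rw [hydroBracket_eq_pairing hI hJ, hydroBracket_eq_pairing hJ hL,
      hydroBracket_eq_pairing hL hI, hydroBracket_eq_pairing (hI.bracket hm hJ) hL,
      hydroBracket_eq_pairing (hJ.bracket hm hL) hI, hydroBracket_eq_pairing (hL.bracket hm hI) hJ,
      pairing_jacobi hm hI hJ hL]

end Bracket

/-! ### Affine solutions -/

section Affine

variable {N : ℕ} (c : Matrix (Fin N) (Fin N) ℝ) (d : Fin N → ℝ)

/-- An equality of functions, so that it also rewrites inside second partial derivatives. -/
theorem pd_affineMapH (s j : Fin N) :
    pd s (fun v => affineMapH c d v j) = fun _ => c j s := by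
  funext u
  have h : HasFDerivAt (fun v : Fin N → ℝ => affineMapH c d v j)
      (∑ k, c j k • (ContinuousLinearMap.proj k : (Fin N → ℝ) →L[ℝ] ℝ)) u :=
    (HasFDerivAt.fun_sum fun k _ => (hasFDerivAt_apply k u).const_mul (c j k)).add_const _
  rw [pd, h.fderiv]
  simp [Pi.single_apply]

theorem pd_const (s : Fin N) (a : ℝ) : pd s (fun _ => a) = fun _ => 0 := by
  funext u
  simp [pd]

theorem solvesFirst_affineMapH (η : Matrix (Fin N) (Fin N) ℝ) :
    SolvesFirst η (affineMapH c d) := by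
  intro u i j k l
  simp [pd_affineMapH, pd_const]

theorem solvesSecond_affineMapH (η : Matrix (Fin N) (Fin N) ℝ) (K : ℝ) :
    SolvesSecond η K (affineMapH c d) := by
  intro u i j k
  simp [pd_affineMapH, pd_const]

theorem canonicalMetric_affineMapH (η : Matrix (Fin N) (Fin N) ℝ) (K : ℝ) :
    canonicalMetric η K (affineMapH c d) = fun u => Matrix.of fun i j =>
      (∑ s, η i s * c j s) + (∑ s, η j s * c i s) - K * u i * u j := by
  funext u
  simp [canonicalMetric, pd_affineMapH]

theorem canonicalConnection_affineMapH (η : Matrix (Fin N) (Fin N) ℝ) (K : ℝ) :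
    canonicalConnection η K (affineMapH c d)
      = fun u i j k => -(K * (if i = k then 1 else 0) * u j) := by
  funext u i j k
  simp only [canonicalConnection, pd_affineMapH, pd_const, mul_zero, Finset.sum_const_zero,
    zero_sub]

end Affine

/-! ### The metric `μ^{ij} - K uⁱ u^j` -/

section Geometry

variable {N : ℕ} {μ : Matrix (Fin N) (Fin N) ℝ} {K : ℝ}

theorem contDiff_quadMetric (μ : Matrix (Fin N) (Fin N) ℝ) (K : ℝ) (i j : Fin N) :
    ContDiff ℝ ∞ (fun u => quadMetric μ K u i j) :=
  contDiff_const.sub ((contDiff_const.mul (contDiff_apply ℝ ℝ i)).mul (contDiff_apply ℝ ℝ j))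

theorem contDiff_det {A : (Fin N → ℝ) → Matrix (Fin N) (Fin N) ℝ}
    (hA : ∀ i j, ContDiff ℝ ∞ (fun u => A u i j)) : ContDiff ℝ ∞ (fun u => (A u).det) := by
  simp only [Matrix.det_apply']
  exact ContDiff.sum fun σ _ => contDiff_const.mul (contDiff_prod fun i _ => hA _ _)

theorem quadMetric_isSymm (hμ : μ.IsSymm) (u : Fin N → ℝ) : (quadMetric μ K u).IsSymm := by
  ext i j
  simp only [Matrix.transpose_apply, quadMetric, Matrix.of_apply, hμ.apply i j]
  ring

/-- Cramer's rule: determinant and adjugate entries are polynomial in `u`. -/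
theorem differentiableAt_covMetric (i j : Fin N) {u : Fin N → ℝ}
    (h : (quadMetric μ K u).det ≠ 0) : DifferentiableAt ℝ (covMetric (quadMetric μ K) i j) u := by
  have h1 : covMetric (quadMetric μ K) i j
      = fun v => (quadMetric μ K v).det⁻¹ * (quadMetric μ K v).adjugate i j := by
    funext v
    rw [covMetric, Matrix.inv_def, Ring.inverse_eq_inv', Matrix.smul_apply, smul_eq_mul]
  have h2 : ContDiff ℝ ∞ (fun v => (quadMetric μ K v).adjugate i j) := by
    simp only [Matrix.adjugate_apply]
    refine contDiff_det fun a b => ?_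
    simp only [Matrix.updateRow_apply]
    split_ifs
    · exact contDiff_const
    · exact contDiff_quadMetric μ K a b
  rw [h1]
  exact (((contDiff_det (contDiff_quadMetric μ K)).differentiable (by simp) u).inv h).mul
    (h2.differentiable (by simp) u)

theorem pd_quadMetric (i j s : Fin N) (u : Fin N → ℝ) :
    pd s (fun v => quadMetric μ K v i j) u
      = -(K * ((if i = s then 1 else 0) * u j + u i * (if j = s then 1 else 0))) := by
  have h : HasFDerivAt (fun v : Fin N → ℝ => quadMetric μ K v i j)
      (-((K * u i) • (ContinuousLinearMap.proj j : (Fin N → ℝ) →L[ℝ] ℝ)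
        + u j • (K • (ContinuousLinearMap.proj i : (Fin N → ℝ) →L[ℝ] ℝ)))) u :=
    (((hasFDerivAt_apply i u).const_mul K).mul (hasFDerivAt_apply j u)).const_sub (μ i j)
  rw [pd, h.fderiv]
  simp only [_root_.neg_apply, _root_.add_apply,
    _root_.smul_apply, ContinuousLinearMap.proj_apply, Pi.single_apply, smul_eq_mul]
  ring

theorem pd_mul {f g : (Fin N → ℝ) → ℝ} {u : Fin N → ℝ} (hf : DifferentiableAt ℝ f u)
    (hg : DifferentiableAt ℝ g u) (s : Fin N) :
    pd s (fun v => f v * g v) u = pd s f u * g u + f u * pd s g u := by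
  rw [pd, (hf.hasFDerivAt.fun_mul hg.hasFDerivAt).fderiv]
  simp only [pd, _root_.add_apply, _root_.smul_apply, smul_eq_mul]
  ring

theorem pd_sum {ι : Type*} {t : Finset ι} {f : ι → (Fin N → ℝ) → ℝ} {u : Fin N → ℝ}
    (hf : ∀ i ∈ t, DifferentiableAt ℝ (f i) u) (s : Fin N) :
    pd s (fun v => ∑ i ∈ t, f i v) u = ∑ i ∈ t, pd s (f i) u := by
  rw [pd, (HasFDerivAt.fun_sum fun i hi => (hf i hi).hasFDerivAt).fderiv]
  simp [pd]

theorem pd_coord (s i : Fin N) (u : Fin N → ℝ) :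
    pd s (fun v => v i) u = if i = s then 1 else 0 := by
  rw [pd, (hasFDerivAt_apply i u).fderiv]
  simp [Pi.single_apply]

theorem pd_congr {f g : (Fin N → ℝ) → ℝ} {u : Fin N → ℝ} (h : f =ᶠ[𝓝 u] g) (s : Fin N) :
    pd s f u = pd s g u := by
  rw [pd, pd, h.fderiv_eq]

theorem eventually_det_ne_zero {u : Fin N → ℝ} (h : (quadMetric μ K u).det ≠ 0) :
    ∀ᶠ v in 𝓝 u, (quadMetric μ K v).det ≠ 0 :=
  (contDiff_det (contDiff_quadMetric μ K)).continuous.continuousAt.eventually_ne h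

theorem sum_quadMetric_mul_covMetric {u : Fin N → ℝ} (h : (quadMetric μ K u).det ≠ 0)
    (i j : Fin N) :
    ∑ a, quadMetric μ K u i a * covMetric (quadMetric μ K) a j u = if i = j then 1 else 0 := by
  have := congrFun (congrFun (Matrix.mul_nonsing_inv (quadMetric μ K u) h.isUnit) i) j
  rwa [Matrix.mul_apply, Matrix.one_apply] at this

theorem sum_covMetric_mul_quadMetric {u : Fin N → ℝ} (h : (quadMetric μ K u).det ≠ 0)
    (i j : Fin N) :
    ∑ a, covMetric (quadMetric μ K) i a u * quadMetric μ K u a j = if i = j then 1 else 0 := by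
  have := congrFun (congrFun (Matrix.nonsing_inv_mul (quadMetric μ K u) h.isUnit) i) j
  rwa [Matrix.mul_apply, Matrix.one_apply] at this

theorem covMetric_symm (hμ : μ.IsSymm) (i j : Fin N) (u : Fin N → ℝ) :
    covMetric (quadMetric μ K) i j u = covMetric (quadMetric μ K) j i u := by
  have h : ((quadMetric μ K u)⁻¹).IsSymm := by
    rw [Matrix.IsSymm, Matrix.transpose_nonsing_inv, (quadMetric_isSymm hμ u).eq]
  exact h.apply j i

/-- The covector `g_{kb} u^b`. -/
def lowered (μ : Matrix (Fin N) (Fin N) ℝ) (K : ℝ) (u : Fin N → ℝ) (k : Fin N) : ℝ :=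
  ∑ b, covMetric (quadMetric μ K) k b u * u b

/-- Differentiate `g^{ab} g_{bk} = δ^a_k`, which holds near `u`, insert the derivative of `g^{ab}`,
and contract with `g_{la}`. -/
theorem pd_covMetric (hμ : μ.IsSymm) {u : Fin N → ℝ} (h : (quadMetric μ K u).det ≠ 0)
    (s l k : Fin N) :
    pd s (covMetric (quadMetric μ K) l k) u
      = K * (covMetric (quadMetric μ K) l s u * lowered μ K u k
        + lowered μ K u l * covMetric (quadMetric μ K) s k u) := by
  have hd : ∀ a b, DifferentiableAt ℝ (fun v => quadMetric μ K v a b) u := fun a b =>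
    (contDiff_quadMetric μ K a b).differentiable (by simp) u
  have h1 : ∀ a, ∑ b, quadMetric μ K u a b * pd s (covMetric (quadMetric μ K) b k) u
      = K * ((if a = s then 1 else 0) * lowered μ K u k
        + u a * covMetric (quadMetric μ K) s k u) := by
    intro a
    have e : pd s (fun v => ∑ b, quadMetric μ K v a b * covMetric (quadMetric μ K) b k v) u = 0 := by
      rw [pd_congr (g := fun _ => if a = k then 1 else 0)
        ((eventually_det_ne_zero h).mono fun v hv => sum_quadMetric_mul_covMetric hv a k),
        pd_const]
    rw [pd_sum fun b _ => (hd a b).fun_mul (differentiableAt_covMetric b k h)] at e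
    simp only [pd_mul (hd a _) (differentiableAt_covMetric _ k h), Finset.sum_add_distrib] at e
    have e2 : ∑ b, pd s (fun v => quadMetric μ K v a b) u * covMetric (quadMetric μ K) b k u
        = -(K * ((if a = s then 1 else 0) * lowered μ K u k
          + u a * covMetric (quadMetric μ K) s k u)) := by
      have e3 : ∑ b, u a * (if b = s then 1 else 0) * covMetric (quadMetric μ K) b k u
          = u a * covMetric (quadMetric μ K) s k u := by
        rw [Finset.sum_eq_single s (fun b _ hb => by simp [hb]) (by simp)]
        simp
      rw [← e3, lowered, Finset.mul_sum, ← Finset.sum_add_distrib, Finset.mul_sum,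
        ← Finset.sum_neg_distrib]
      refine Finset.sum_congr rfl fun b _ => ?_
      rw [pd_quadMetric a b s u, covMetric_symm hμ k b]
      ring
    linarith
  have h2 : pd s (covMetric (quadMetric μ K) l k) u
      = ∑ a, covMetric (quadMetric μ K) l a u
        * ∑ b, quadMetric μ K u a b * pd s (covMetric (quadMetric μ K) b k) u := by
    simp only [Finset.mul_sum, ← mul_assoc]
    rw [Finset.sum_comm]
    simp only [← Finset.sum_mul, sum_covMetric_mul_quadMetric h]
    simp
  rw [h2]
  simp only [h1]
  have e4 : ∑ a, covMetric (quadMetric μ K) l a u * (if a = s then 1 else 0)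
      = covMetric (quadMetric μ K) l s u := by simp
  rw [← e4, lowered.eq_1 μ K u l, Finset.sum_mul, Finset.sum_mul, ← Finset.sum_add_distrib,
    Finset.mul_sum]
  exact Finset.sum_congr rfl fun a _ => by ring

/-- In the combination of three derivatives all terms cancel except `2K g_{sk} y_l`, where `y` is
`lowered`; raising `y` returns `u`. -/
theorem christoffel_quadMetric (hμ : μ.IsSymm) {u : Fin N → ℝ} (h : (quadMetric μ K u).det ≠ 0)
    (j s k : Fin N) :
    christoffel (quadMetric μ K) j s k u = K * u j * covMetric (quadMetric μ K) s k u := by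
  have h1 : ∀ l, pd s (covMetric (quadMetric μ K) l k) u + pd k (covMetric (quadMetric μ K) l s) u
      - pd l (covMetric (quadMetric μ K) s k) u
      = 2 * K * covMetric (quadMetric μ K) s k u * lowered μ K u l := by
    intro l
    rw [pd_covMetric hμ h, pd_covMetric hμ h, pd_covMetric hμ h, covMetric_symm hμ s l,
      covMetric_symm hμ k s]
    ring
  have h2 : ∑ l, quadMetric μ K u j l * lowered μ K u l = u j := by
    simp only [lowered, Finset.mul_sum, ← mul_assoc]
    rw [Finset.sum_comm]
    simp only [← Finset.sum_mul, sum_quadMetric_mul_covMetric h]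
    simp
  rw [christoffel]
  simp only [h1]
  rw [← h2, Finset.mul_sum, Finset.mul_sum, Finset.sum_mul]
  exact Finset.sum_congr rfl fun l _ => by ring

theorem contraChristoffel_quadMetric (hμ : μ.IsSymm) {u : Fin N → ℝ}
    (h : (quadMetric μ K u).det ≠ 0) (i j k : Fin N) :
    contraChristoffel (quadMetric μ K) i j k u = K * (if i = k then 1 else 0) * u j := by
  rw [contraChristoffel, ← sum_quadMetric_mul_covMetric h i k, Finset.mul_sum, Finset.sum_mul]
  refine Finset.sum_congr rfl fun s _ => ?_
  rw [christoffel_quadMetric hμ h]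
  ring

theorem pd_christoffel (hμ : μ.IsSymm) {u : Fin N → ℝ} (h : (quadMetric μ K u).det ≠ 0)
    (i j k l : Fin N) :
    pd k (christoffel (quadMetric μ K) i l j) u
      = K * (if i = k then 1 else 0) * covMetric (quadMetric μ K) l j u
        + K * u i * pd k (covMetric (quadMetric μ K) l j) u := by
  have hi : DifferentiableAt ℝ (fun v : Fin N → ℝ => v i) u := differentiableAt_apply i u
  have hK : DifferentiableAt ℝ (fun _ : Fin N → ℝ => K) u := differentiableAt_const K
  -- The closed form may be differentiated because it holds on a whole neighbourhood of `u`.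
  rw [pd_congr ((eventually_det_ne_zero h).mono fun v hv => christoffel_quadMetric hμ hv i l j),
    pd_mul (hK.fun_mul hi) (differentiableAt_covMetric l j h), pd_mul hK hi, pd_const, pd_coord]
  ring

/-- The quadratic terms `K² uⁱ (y_k g_{lj} - y_l g_{kj})` are cancelled by `K uⁱ (∂_k g_{lj} - ∂_l
g_{kj})`; what remains comes from `∂_k uⁱ = δⁱ_k`. -/
theorem riemann_quadMetric (hμ : μ.IsSymm) {u : Fin N → ℝ} (h : (quadMetric μ K u).det ≠ 0)
    (i j k l : Fin N) :
    riemann (quadMetric μ K) i j k l u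
      = K * ((if i = k then 1 else 0) * covMetric (quadMetric μ K) j l u
        - (if i = l then 1 else 0) * covMetric (quadMetric μ K) j k u) := by
  have h1 : ∑ m, (christoffel (quadMetric μ K) i k m u * christoffel (quadMetric μ K) m l j u
      - christoffel (quadMetric μ K) i l m u * christoffel (quadMetric μ K) m k j u)
      = K * K * u i * (lowered μ K u k * covMetric (quadMetric μ K) l j u
        - lowered μ K u l * covMetric (quadMetric μ K) k j u) := by
    rw [lowered, lowered, Finset.sum_mul, Finset.sum_mul, ← Finset.sum_sub_distrib, Finset.mul_sum]
    refine Finset.sum_congr rfl fun m _ => ?_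
    simp only [christoffel_quadMetric hμ h]
    ring
  rw [riemann, h1, pd_christoffel hμ h, pd_christoffel hμ h, pd_covMetric hμ h,
    pd_covMetric hμ h, covMetric_symm hμ l j, covMetric_symm hμ k j, covMetric_symm hμ l k]
  ring

theorem isConstantCurvatureMetricOn_quadMetric (hμ : μ.IsSymm) {Ω : Set (Fin N → ℝ)}
    (hΩ : ∀ u ∈ Ω, (quadMetric μ K u).det ≠ 0) :
    IsConstantCurvatureMetricOn (quadMetric μ K) K Ω where
  smooth i j := (contDiff_quadMetric μ K i j).contDiffOn
  symm u _ := quadMetric_isSymm hμ u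
  nondegenerate := hΩ
  curvature u hu i j k l := riemann_quadMetric hμ (hΩ u hu) i j k l

theorem eventually_det_quadMetric_ne_zero (h : μ.det ≠ 0) :
    ∀ᶠ u in 𝓝 (0 : Fin N → ℝ), (quadMetric μ K u).det ≠ 0 := by
  refine eventually_det_ne_zero ?_
  convert h
  ext i j
  simp [quadMetric]

end Geometry

end HydroBracket

end

theorem mainTheorem8 (N : ℕ) (K : ℝ) :
    -- affine functions solve both systems, and the corresponding bracket is Poisson
    (∀ η : Matrix (Fin N) (Fin N) ℝ, η.IsSymm → η.det ≠ 0 →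
      ∀ (c : Matrix (Fin N) (Fin N) ℝ) (d : Fin N → ℝ),
        HydroBracket.SolvesFirst η (HydroBracket.affineMapH c d) ∧
        HydroBracket.SolvesSecond η K (HydroBracket.affineMapH c d) ∧
        HydroBracket.canonicalMetric η K (HydroBracket.affineMapH c d)
          = (fun u => Matrix.of fun i j =>
              (∑ s, η i s * c j s) + (∑ s, η j s * c i s) - K * u i * u j) ∧
        HydroBracket.canonicalConnection η K (HydroBracket.affineMapH c d)
          = (fun u i j k => -(K * (if i = k then 1 else 0) * u j)) ∧
        HydroBracket.IsPoisson
          (fun u => Matrix.of fun i j =>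
              (∑ s, η i s * c j s) + (∑ s, η j s * c i s) - K * u i * u j)
          (fun u i j k => -(K * (if i = k then 1 else 0) * u j)) K) ∧
    -- the metric `μ^{ij} - K uⁱ u^j`
    (∀ μ : Matrix (Fin N) (Fin N) ℝ, μ.IsSymm →
      (∀ Ω : Set (Fin N → ℝ), IsOpen Ω → (∀ u ∈ Ω, (HydroBracket.quadMetric μ K u).det ≠ 0) →
        HydroBracket.IsConstantCurvatureMetricOn (HydroBracket.quadMetric μ K) K Ω ∧
        ∀ u ∈ Ω, ∀ i j k : Fin N,
          HydroBracket.contraChristoffel (HydroBracket.quadMetric μ K) i j k u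
            = K * (if i = k then 1 else 0) * u j) ∧
      (μ.det ≠ 0 → ∀ᶠ u in nhds (0 : Fin N → ℝ), (HydroBracket.quadMetric μ K u).det ≠ 0)) := by
  refine ⟨fun η _ _ c d => ⟨HydroBracket.solvesFirst_affineMapH c d η,
    HydroBracket.solvesSecond_affineMapH c d η K, HydroBracket.canonicalMetric_affineMapH c d η K,
    HydroBracket.canonicalConnection_affineMapH c d η K, ?_⟩, fun μ hμ => ⟨fun Ω _ hdet =>
    ⟨HydroBracket.isConstantCurvatureMetricOn_quadMetric hμ hdet, fun u hu i j k =>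
      HydroBracket.contraChristoffel_quadMetric hμ (hdet u hu) i j k⟩,
    HydroBracket.eventually_det_quadMetric_ne_zero⟩⟩
  -- The constant part `η cᵀ + c ηᵀ` is symmetric for every `c`: transposition exchanges its two
  -- summands.
  exact HydroBracket.isPoisson_quadMetric
    (m := Matrix.of fun i j => (∑ s, η i s * c j s) + ∑ s, η j s * c i s)
    (Matrix.IsSymm.ext fun i j => add_comm _ _)
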